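/- Let $L\ge 2$ and let $d_0,\dots,d_L$ be layer widths with $d_i\ge\min(d_0,d_L)$ for all $i$. For $\mathbf W=(W_1,\dots,W_L)$ with $W_i\in\mathbb R^{d_i\times d_{i-1}}$ put $E(\mathbf W)=W_LW_{L-1}\cdots W_1$. For a single measurement matrix $A\in\mathbb R^{d_L\times d_0}$ and a label $b\in\mathbb R$ consider the loss $\mathcal L(\mathbf W)=(\langle A,E(\mathbf W)\rangle-b)^2$, where $\langle A,B\rangle=\mathrm{tr}(A^\top B)$. For $M\in\mathbb R^{d_L\times d_0}$ define the induced regularizer $$F(M)=\inf_{\mathbf W:\,E(\mathbf W)=M}\mathrm{tr}\big[\nabla^2\mathcal L(\mathbf W)\big],$$ where $\nabla^2\mathcal L$ is the Hessian with respect to all entries of $W_1,\dots,W_L$. Then for every $M\in\mathbb R^{d_L\times d_0}$ the infimum is over a non-empty set that is bounded below, and $$F(M)=2L\,\big\|(A^\top M)^{L-1}A^\top\big\|_{S_{2/L}}^{2/L},$$ where $\|X\|_{S_p}=\big(\sum_{i}\sigma_i(X)^p\big)^{1/p}$, with the sum over the singular values of $X$, is the Schatten $p$-(quasi)norm. Moreover,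 the infimum is attained (it is a minimum) whenever $$\mathrm{rank}(A^\top M)=\mathrm{rank}(MA^\top)=\mathrm{rank}\big((A^\top M)^{L-1}A^\top\big),$$ in particular whenever $d_0=d_L$ and $A$ and $M$ are invertible. -/

import Mathlib

noncomputable section

namespace DeepLinear

/-- Index set of the scalar parameters of an `L`-layer linear network with widths
`d 0, …, d L`: one index `⟨i, (a, c)⟩` for each entry of each layer matrix. Layers are counted
from `0`, so that layer `i : Fin L` has size `d (i + 1) × d i`. -/
abbrev ParamIdx (L : ℕ) (d : ℕ → ℕ) : Type :=
  Σ i : Fin L, Fin (d (i + 1)) × Fin (d i)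

/-- The parameter space: all layer matrices, concatenated into one Euclidean vector. -/
abbrev Params (L : ℕ) (d : ℕ → ℕ) : Type :=
  EuclideanSpace ℝ (ParamIdx L d)

/-- The `i`-th layer matrix of a parameter vector. -/
def layer {L : ℕ} {d : ℕ → ℕ} (W : Params L d) (i : Fin L) :
    Matrix (Fin (d (i + 1))) (Fin (d i)) ℝ :=
  Matrix.of fun a c => W ⟨i, (a, c)⟩

/-- The product (layer `k - 1`) * ⋯ * (layer `0`) of the first `k` layer matrices. -/
def partialProd {L : ℕ} {d : ℕ → ℕ} (W : Params L d) :
    (k : ℕ) → k ≤ L → Matrix (Fin (d k)) (Fin (d 0)) ℝ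
  | 0, _ => 1
  | k + 1, h => layer W ⟨k, h⟩ * partialProd W k (Nat.le_of_succ_le h)

/-- The end-to-end matrix of a parameter vector: the product of all layer matrices. -/
def endToEnd {L : ℕ} {d : ℕ → ℕ} (W : Params L d) : Matrix (Fin (d L)) (Fin (d 0)) ℝ :=
  partialProd W L le_rfl

/-- The trace inner product of two real matrices. -/
def matInner {m n : ℕ} (A B : Matrix (Fin m) (Fin n) ℝ) : ℝ :=
  (A.transpose * B).trace

/-- The mean squared error of the network on `n` linear measurements `A` with labels `b`. -/
def loss {L : ℕ} {d : ℕ → ℕ} {n : ℕ} (A : Fin n → Matrix (Fin (d L)) (Fin (d 0)) ℝ)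
    (b : Fin n → ℝ) (W : Params L d) : ℝ :=
  (1 / (n : ℝ)) * ∑ i, (matInner (A i) (endToEnd W) - b i) ^ 2

/-- The Hessian matrix of a real function on a Euclidean space. -/
def hessian {ι : Type*} [Fintype ι] [DecidableEq ι] (f : EuclideanSpace ℝ ι → ℝ)
    (x : EuclideanSpace ℝ ι) : Matrix ι ι ℝ :=
  Matrix.of fun i j =>
    iteratedFDeriv ℝ 2 f x ![EuclideanSpace.single i 1, EuclideanSpace.single j 1]

/-- The traces of the Hessian of the loss at the parameters whose end-to-end matrix is `M`. -/
def hessianTraces {L : ℕ} {d : ℕ → ℕ} {n : ℕ} (A : Fin n → Matrix (Fin (d L)) (Fin (d 0)) ℝ)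
    (b : Fin n → ℝ) (M : Matrix (Fin (d L)) (Fin (d 0)) ℝ) : Set ℝ :=
  {t | ∃ W : Params L d, endToEnd W = M ∧ (hessian (loss A b) W).trace = t}

/-- The induced regularizer: the infimum of the trace of the Hessian of the loss over all
parameters with end-to-end matrix `M`. -/
def inducedRegularizer {L : ℕ} {d : ℕ → ℕ} {n : ℕ}
    (A : Fin n → Matrix (Fin (d L)) (Fin (d 0)) ℝ)
    (b : Fin n → ℝ) (M : Matrix (Fin (d L)) (Fin (d 0)) ℝ) : ℝ :=
  sInf (hessianTraces A b M)

/-- The Schatten `p`-(quasi)norm: the `ℓ^p` (quasi)norm of the `min m n` singular values. -/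
def schattenNorm {m n : ℕ} (p : ℝ) (M : Matrix (Fin m) (Fin n) ℝ) : ℝ :=
  (∑ i ∈ Finset.range (min m n), (Matrix.toEuclideanLin M).singularValues i ^ p) ^ (1 / p)

end DeepLinear

end

noncomputable section

namespace DeepLinear

open InnerProductSpace

/-! ### Gram–Schmidt norms under linear maps -/

section GramSchmidt

variable {ι E F : Type*} [LinearOrder ι] [LocallyFiniteOrderBot ι] [WellFoundedLT ι]
  [NormedAddCommGroup E] [InnerProductSpace ℝ E] [NormedAddCommGroup F] [InnerProductSpace ℝ F]

/-! The loss restricted to a coordinate line is the square of an affine function, so the trace of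
the Hessian is `2 ∑ ‖G_i‖_F²`, with `G_i` the transposed layer gradients of `⟨A, E(W)⟩`
(`trace_hessian_loss_one`). With `B = Aᵀ`, the product of all `G_i` telescopes to `X = (B M)^(L-1)
B`, whichever factorization `W` of `M` is used (`gradProd_zero`).

Lower bound (`mul_sum_singVal_rpow_le`): push the right singular vectors of `X` through the `G_i`
one at a time and apply Gram–Schmidt at each level. The `j`-th norm goes from `1` to `σ_j(X)`,
growing at each level by at most the length of the image of a normalized Gram–Schmidt vector. By
Bessel the squares of these lengths sum over `j` to at most `‖G_i‖_F²`; AM-GM over the layers, for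
each `j`, concludes.

Upper bound: factor `M = M₂ M₁` through `ℝ^m`, `m = rank M`, and embed `ℝ^m` into each hidden space.
Only the inner products `H_k` induced on `ℝ^m` matter, and any positive definite ones can occur
(`exists_params_of_cost`). They now weigh the factors of `X = C1 C^N CL`, where `C1 = B M₂`, `C = M₁
B M₂`, `CL = M₁ B`. Each intermediate space splits into signal, on which every factor scales the
`j`-th vector by `σ_j^(1/L)`, and noise. Declaring the signal vectors orthonormal and orthogonal to
the noise makes every factor cost `∑ σ_j^(2/L)` plus a noise term. The noise costs can be made
arbitrarily small (`exists_cost_le`), and under the rank conditions the noise is annihilated and the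
bound is attained (`exists_cost_le_of_rank_le`). -/

theorem inner_gramSchmidt_self (v : ι → E) (j : ι) :
    inner ℝ (gramSchmidt ℝ v j) (v j) = ‖gramSchmidt ℝ v j‖ ^ 2 := by
  conv_lhs => rw [gramSchmidt_def'' ℝ v j]
  rw [inner_add_right, inner_sum, Finset.sum_eq_zero, add_zero, real_inner_self_eq_norm_sq]
  intro i hi
  rw [inner_smul_right, gramSchmidt_orthogonal ℝ v (Finset.mem_Iio.1 hi).ne', mul_zero]

/-- `T (v j)` and the image of the `j`-th Gram–Schmidt vector differ by an element of the span of
the earlier `T (v i)`, to which the new Gram–Schmidt vector is orthogonal. -/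
theorem inner_gramSchmidt_map (T : E →ₗ[ℝ] F) (v : ι → E) (j : ι) :
    inner ℝ (gramSchmidt ℝ (fun i => T (v i)) j) (T (gramSchmidt ℝ v j)) =
      ‖gramSchmidt ℝ (fun i => T (v i)) j‖ ^ 2 := by
  set w := fun i => T (v i) with hw
  have hlt : ∀ i < j, inner ℝ (gramSchmidt ℝ w j) (T (gramSchmidt ℝ v i)) = 0 := by
    intro i hi
    have hmem := gramSchmidt_mem_span ℝ v (le_refl i)
    refine Submodule.span_induction (p := fun x _ => inner ℝ (gramSchmidt ℝ w j) (T x) = 0)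
      ?_ ?_ ?_ ?_ hmem
    · rintro _ ⟨k, hk, rfl⟩
      exact gramSchmidt_inv_triangular ℝ w (lt_of_le_of_lt hk hi)
    · simp
    · intro x y _ _ hx hy
      rw [map_add, inner_add_right, hx, hy, add_zero]
    · intro a x _ hx
      rw [map_smul, inner_smul_right, hx, mul_zero]
  have h := inner_gramSchmidt_self w j
  rw [← h]
  have h2 : w j = T (gramSchmidt ℝ v j) + ∑ i ∈ Finset.Iio j,
      (inner ℝ (gramSchmidt ℝ v i) (v j) / ‖gramSchmidt ℝ v i‖ ^ 2) • T (gramSchmidt ℝ v i) := by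
    have := congrArg T (gramSchmidt_def'' ℝ v j)
    rw [map_add, map_sum] at this
    simpa [hw] using this
  rw [h2, inner_add_right, inner_sum, Finset.sum_eq_zero, add_zero]
  intro i hi
  rw [inner_smul_right, hlt i (Finset.mem_Iio.1 hi), mul_zero]

/-- A linear map expands the Gram-Schmidt norms of a family at most by its norms on the
normalized Gram-Schmidt vectors. -/
theorem norm_gramSchmidt_map_le (T : E →ₗ[ℝ] F) (v : ι → E) (j : ι) :
    ‖gramSchmidt ℝ (fun i => T (v i)) j‖ ≤
      ‖T (gramSchmidtNormed ℝ v j)‖ * ‖gramSchmidt ℝ v j‖ := by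
  have h := inner_gramSchmidt_map T v j
  set g := gramSchmidt ℝ (fun i => T (v i)) j
  have hT : ‖T (gramSchmidt ℝ v j)‖ =
      ‖T (gramSchmidtNormed ℝ v j)‖ * ‖gramSchmidt ℝ v j‖ := by
    by_cases h0 : gramSchmidt ℝ v j = 0
    · simp [h0]
    · have : ‖gramSchmidt ℝ v j‖ ≠ 0 := norm_ne_zero_iff.2 h0
      simp only [gramSchmidtNormed, map_smul, norm_smul]
      simp
      field_simp
  rw [← hT]
  have h1 := real_inner_le_norm g (T (gramSchmidt ℝ v j))
  rw [h, sq] at h1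
  by_cases hg : ‖g‖ = 0
  · rw [hg]; positivity
  · exact le_of_mul_le_mul_left h1 (lt_of_le_of_ne (norm_nonneg _) (Ne.symm hg))

end GramSchmidt

/-! ### Frobenius norms, singular values and AM-GM -/

/-- The squared Frobenius norm of a real matrix. -/
def frobSq {m n : Type*} [Fintype m] [Fintype n] (G : Matrix m n ℝ) : ℝ :=
  ∑ i, ∑ j, G i j ^ 2

theorem frobSq_eq_trace {m n : Type*} [Fintype m] [Fintype n] (G : Matrix m n ℝ) :
    frobSq G = (G.transpose * G).trace := by
  simp only [frobSq, Matrix.trace, Matrix.diag, Matrix.mul_apply, Matrix.transpose_apply, ← sq]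
  exact Finset.sum_comm

/-- Bessel's inequality for each row of `G`. The family `v` may be dependent: the vanishing
normalized vectors contribute nothing and the others are orthonormal. -/
theorem sum_norm_sq_gramSchmidtNormed_le {N : ℕ} {m n : Type*} [Fintype m] [Fintype n]
    [DecidableEq n] (G : Matrix m n ℝ) (v : Fin N → EuclideanSpace ℝ n) :
    ∑ j, ‖Matrix.toEuclideanLin G (gramSchmidtNormed ℝ v j)‖ ^ 2 ≤ frobSq G := by
  have hrow : ∀ a, ∑ j, (Matrix.toEuclideanLin G (gramSchmidtNormed ℝ v j)) a ^ 2 ≤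
      ∑ c, G a c ^ 2 := by
    intro a
    have hb := (gramSchmidtNormed_orthonormal' (𝕜 := ℝ) v).sum_inner_products_le
      (WithLp.toLp 2 (G a)) (s := Finset.univ)
    rw [EuclideanSpace.norm_sq_eq] at hb
    simp only [Real.norm_eq_abs, sq_abs] at hb
    refine le_trans (le_of_eq ?_) hb
    symm
    have e := Finset.sum_subtype_of_mem (s := Finset.univ.filter
        (fun i => gramSchmidtNormed ℝ v i ≠ 0)) (p := fun i => gramSchmidtNormed ℝ v i ≠ 0)
      (f := fun i => (inner ℝ (gramSchmidtNormed ℝ v i) (WithLp.toLp 2 (G a)) : ℝ) ^ 2)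
      (by simp)
    have e2 : ∀ j, (Matrix.toEuclideanLin G (gramSchmidtNormed ℝ v j)) a =
        inner ℝ (gramSchmidtNormed ℝ v j) (WithLp.toLp 2 (G a)) := by
      intro j
      simp [Matrix.toLpLin_apply, PiLp.inner_apply, Matrix.mulVec, dotProduct]
    simp only [e2]
    rw [← Finset.sum_filter_of_ne (p := fun i => gramSchmidtNormed ℝ v i ≠ 0), ← e]
    · apply Finset.sum_congr
      · ext x; have := x.2; simp only [Set.mem_ofPred_eq] at this; simp [this]
      · intro i _; rfl
    · intro i _ h h0
      exact h (by simp [h0])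
  simp only [EuclideanSpace.norm_sq_eq, Real.norm_eq_abs, sq_abs]
  rw [Finset.sum_comm]
  exact Finset.sum_le_sum fun a _ => hrow a

/-- The singular values of a real matrix, indexed by its columns. -/
def singVal {m n : ℕ} (X : Matrix (Fin m) (Fin n) ℝ) (j : Fin n) : ℝ :=
  (Matrix.toEuclideanLin X).singularValues j

theorem singVal_nonneg {m n : ℕ} (X : Matrix (Fin m) (Fin n) ℝ) (j : Fin n) : 0 ≤ singVal X j :=
  LinearMap.singularValues_nonneg _ _

/-- The columns beyond `min m n` only add zero singular values, because the rank is at most `m`;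
positivity of `p` makes their powers vanish. -/
theorem schattenNorm_rpow {m n : ℕ} {p : ℝ} (hp : 0 < p) (X : Matrix (Fin m) (Fin n) ℝ) :
    schattenNorm p X ^ p = ∑ j, singVal X j ^ p := by
  unfold schattenNorm singVal
  rw [← Real.rpow_mul, one_div, inv_mul_cancel₀ hp.ne', Real.rpow_one]
  · rw [← Fin.sum_univ_eq_sum_range (fun i => (Matrix.toEuclideanLin X).singularValues i ^ p),
      Fin.sum_univ_eq_sum_range (fun i => (Matrix.toEuclideanLin X).singularValues i ^ p),
      Fin.sum_univ_eq_sum_range (fun i => (Matrix.toEuclideanLin X).singularValues i ^ p)]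
    refine Finset.sum_subset (Finset.range_subset_range.2 (min_le_right m n)) ?_
    intro i hi hi'
    rw [Finset.mem_range] at hi hi'
    have hmi : m ≤ i := by
      by_contra h
      exact hi' (lt_min (not_le.1 h) hi)
    have h0 : (Matrix.toEuclideanLin X).singularValues i = 0 := by
      rw [LinearMap.singularValues_eq_zero_iff_le_finrank_range]
      refine le_trans (Submodule.finrank_le _) ?_
      simpa using hmi
    rw [h0, Real.zero_rpow hp.ne']
  · exact Finset.sum_nonneg fun i _ => Real.rpow_nonneg (LinearMap.singularValues_nonneg _ _) _

/-- Right singular vectors. -/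
theorem exists_singular_basis {m n : ℕ} (X : Matrix (Fin m) (Fin n) ℝ) :
    ∃ v : OrthonormalBasis (Fin n) ℝ (EuclideanSpace ℝ (Fin n)), ∀ i j,
      inner ℝ (Matrix.toEuclideanLin X (v i)) (Matrix.toEuclideanLin X (v j)) =
        if i = j then singVal X i ^ 2 else 0 := by
  have hn : Module.finrank ℝ (EuclideanSpace ℝ (Fin n)) = n := by simp
  set T := Matrix.toEuclideanLin X with hT
  refine ⟨T.isSymmetric_adjoint_comp_self.eigenvectorBasis hn, fun i j => ?_⟩
  have h := T.isSymmetric_adjoint_comp_self.apply_eigenvectorBasis hn j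
  rw [← LinearMap.adjoint_inner_right]
  rw [LinearMap.comp_apply] at h
  rw [h, inner_smul_right, (orthonormal_iff_ite.1
    (T.isSymmetric_adjoint_comp_self.eigenvectorBasis hn).orthonormal) i j, singVal,
    LinearMap.sq_singularValues_fin _ hn]
  split_ifs with hij
  · simp [hij]
  · simp

theorem exists_singular_matrix {m n : ℕ} (X : Matrix (Fin m) (Fin n) ℝ) :
    ∃ V : Matrix (Fin n) (Fin n) ℝ, V.transpose * V = 1 ∧ V * V.transpose = 1 ∧
      V.transpose * X.transpose * X * V = Matrix.diagonal fun j => singVal X j ^ 2 := by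
  obtain ⟨v, hv⟩ := exists_singular_basis X
  set V : Matrix (Fin n) (Fin n) ℝ := Matrix.of fun a j => v j a with hV
  have h1 : V.transpose * V = 1 := by
    ext i j
    have := (orthonormal_iff_ite.1 v.orthonormal) i j
    rw [Matrix.one_apply, ← this]
    simp [Matrix.mul_apply, hV, PiLp.inner_apply, mul_comm]
  refine ⟨V, h1, mul_eq_one_comm.1 h1, ?_⟩
  have e : V.transpose * X.transpose * X * V = (X * V).transpose * (X * V) := by
    rw [Matrix.transpose_mul]; simp only [Matrix.mul_assoc]
  rw [e]
  ext i j
  rw [Matrix.diagonal_apply, ← hv i j]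
  simp [Matrix.mul_apply, hV, PiLp.inner_apply, mul_comm, Matrix.toLpLin_apply, Matrix.mulVec,
    dotProduct]

/-- AM-GM with equal weights `1 / L` for the squares `τ i ^ 2`. -/
theorem rpow_two_div_prod_le {L : ℕ} (hL : 0 < L) (τ : ℕ → ℝ) {s : ℝ}
    (hs : 0 ≤ s) (h : s ≤ ∏ i ∈ Finset.range L, τ i) :
    (L : ℝ) * s ^ (2 / (L : ℝ)) ≤ ∑ i ∈ Finset.range L, τ i ^ 2 := by
  have hL' : (0 : ℝ) < L := by exact_mod_cast hL
  have hw := Real.geom_mean_le_arith_mean_weighted (Finset.range L) (fun _ => 1 / (L : ℝ))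
    (fun i => τ i ^ 2) (fun _ _ => by positivity) (by simp [hL'.ne']) (fun i _ => sq_nonneg _)
  have h1 : s ^ (2 / (L : ℝ)) ≤ ∏ i ∈ Finset.range L, (τ i ^ 2) ^ (1 / (L : ℝ)) := by
    rw [Real.finsetProd_rpow _ _ fun i _ => sq_nonneg _, Finset.prod_pow]
    have : s ^ (2 / (L : ℝ)) = (s ^ 2) ^ (1 / (L : ℝ)) := by
      rw [← Real.rpow_natCast s 2, ← Real.rpow_mul hs]; congr 1; push_cast; ring
    rw [this]
    exact Real.rpow_le_rpow (sq_nonneg _) (pow_le_pow_left₀ hs h 2) (by positivity)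
  have h2 := h1.trans hw
  rw [← Finset.mul_sum] at h2
  have h3 := mul_le_mul_of_nonneg_left h2 hL'.le
  refine h3.trans (le_of_eq ?_)
  field_simp

theorem le_prod_mul_of_le_mul_succ {L : ℕ} (g τ : ℕ → ℝ) (h0 : ∀ i, 0 ≤ τ i)
    (h : ∀ i, i < L → g i ≤ τ i * g (i + 1)) :
    g 0 ≤ (∏ i ∈ Finset.range L, τ i) * g L := by
  induction L with
  | zero => simp
  | succ n ih =>
    refine (ih fun i hi => h i (by omega)).trans ?_
    rw [Finset.prod_range_succ, mul_assoc]
    exact mul_le_mul_of_nonneg_left (h n (by omega)) (Finset.prod_nonneg fun i _ => h0 i)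

/-! ### The trace of the Hessian -/

section Network

variable {L : ℕ} {d : ℕ → ℕ}

/-- The product (layer `L - 1`) * ⋯ * (layer `k`) of the last layer matrices. -/
def suffixProd (W : Params L d) (k : ℕ) (h : k ≤ L) : Matrix (Fin (d L)) (Fin (d k)) ℝ :=
  Nat.decreasingInduction (motive := fun m _ => Matrix (Fin (d L)) (Fin (d m)) ℝ)
    (fun m hm S => S * layer W ⟨m, hm⟩) 1 h

theorem suffixProd_self (W : Params L d) : suffixProd W L le_rfl = 1 :=
  Nat.decreasingInduction_self _ _

theorem suffixProd_eq_mul (W : Params L d) (k : ℕ) (h : k < L) :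
    suffixProd W k h.le = suffixProd W (k + 1) h * layer W ⟨k, h⟩ :=
  Nat.decreasingInduction_succ_left _ _ _ _

theorem suffixProd_mul_partialProd (W : Params L d) (k : ℕ) (h : k ≤ L) :
    suffixProd W k h * partialProd W k h = endToEnd W := by
  induction h using Nat.decreasingInduction with
  | self => rw [suffixProd_self, Matrix.one_mul, endToEnd]
  | of_succ k hk ih =>
    rw [← ih, suffixProd_eq_mul W k hk, partialProd, Matrix.mul_assoc]

theorem partialProd_congr {W W' : Params L d} (k : ℕ) (h : k ≤ L)
    (hW : ∀ i (hi : i < k), layer W ⟨i, hi.trans_le h⟩ = layer W' ⟨i, hi.trans_le h⟩) :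
    partialProd W k h = partialProd W' k h := by
  induction k with
  | zero => rfl
  | succ k ih =>
    rw [partialProd, partialProd, hW k (Nat.lt_succ_self k),
      ih (Nat.le_of_succ_le h) fun i hi => hW i (hi.trans (Nat.lt_succ_self k))]

theorem suffixProd_congr {W W' : Params L d} (k : ℕ) (h : k ≤ L)
    (hW : ∀ i (hi : i < L), k ≤ i → layer W ⟨i, hi⟩ = layer W' ⟨i, hi⟩) :
    suffixProd W k h = suffixProd W' k h := by
  induction h using Nat.decreasingInduction with
  | self => rw [suffixProd_self, suffixProd_self]
  | of_succ k hk ih =>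
    rw [suffixProd_eq_mul W k hk, suffixProd_eq_mul W' k hk, hW k hk le_rfl,
      ih fun i hi hki => hW i hi ((Nat.le_succ k).trans hki)]

/-- The transposed gradient of `⟨A, W_L ⋯ W_1⟩` with respect to the `i`-th layer. -/
def layerGrad (B : Matrix (Fin (d 0)) (Fin (d L)) ℝ) (W : Params L d) (i : Fin L) :
    Matrix (Fin (d i)) (Fin (d (i + 1))) ℝ :=
  partialProd W i i.2.le * B * suffixProd W (i + 1) i.2

theorem layer_add_smul_single_same (W : Params L d) (i : Fin L) (a : Fin (d (i + 1)))
    (c : Fin (d i)) (t : ℝ) :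
    layer (W + t • EuclideanSpace.single ⟨i, (a, c)⟩ 1) i =
      layer W i + t • Matrix.single a c 1 := by
  ext p q
  simp only [layer, Matrix.of_apply, PiLp.add_apply, PiLp.smul_apply, Matrix.add_apply,
    Matrix.smul_apply, Matrix.single_apply, EuclideanSpace.single, PiLp.single_apply]
  congr 2
  by_cases h : a = p ∧ c = q
  · obtain ⟨rfl, rfl⟩ := h; simp
  · rw [if_neg h, if_neg]
    intro h'
    simp only [Sigma.mk.injEq, heq_eq_eq, Prod.mk.injEq, true_and] at h'
    exact h ⟨h'.1.symm, h'.2.symm⟩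

theorem layer_add_smul_single_of_ne (W : Params L d) (i j : Fin L) (hij : j ≠ i)
    (a : Fin (d (i + 1))) (c : Fin (d i)) (t : ℝ) :
    layer (W + t • EuclideanSpace.single ⟨i, (a, c)⟩ 1) j = layer W j := by
  ext p q
  simp only [layer, Matrix.of_apply, PiLp.add_apply, PiLp.smul_apply, EuclideanSpace.single,
    PiLp.single_apply]
  rw [if_neg]
  · simp
  · intro h
    exact hij (congrArg Sigma.fst h)

/-- The end-to-end matrix is multilinear in the layers, so it is affine in any single entry. -/
theorem matInner_endToEnd_add_smul_single (A : Matrix (Fin (d L)) (Fin (d 0)) ℝ)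
    (W : Params L d) (i : Fin L) (a : Fin (d (i + 1))) (c : Fin (d i)) (t : ℝ) :
    matInner A (endToEnd (W + t • EuclideanSpace.single ⟨i, (a, c)⟩ 1)) =
      matInner A (endToEnd W) + t * layerGrad A.transpose W i c a := by
  set W' := W + t • EuclideanSpace.single (⟨i, (a, c)⟩ : ParamIdx L d) (1 : ℝ) with hW'
  have h1 : partialProd W' i i.2.le = partialProd W i i.2.le :=
    partialProd_congr _ _ fun j hj => layer_add_smul_single_of_ne W i _
      (fun h => hj.ne (congrArg Fin.val h)) a c t
  have h2 : suffixProd W' (i + 1) i.2 = suffixProd W (i + 1) i.2 :=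
    suffixProd_congr _ _ fun j hj hij => layer_add_smul_single_of_ne W i _
      (fun h => by have := congrArg Fin.val h; simp at this; omega) a c t
  have h3 : layer W' i = layer W i + t • Matrix.single a c 1 :=
    layer_add_smul_single_same W i a c t
  have e : ∀ W : Params L d, endToEnd W =
      suffixProd W (i + 1) i.2 * (layer W i * partialProd W i i.2.le) := fun W => by
    rw [← suffixProd_mul_partialProd W (i + 1) i.2]; rfl
  rw [e W', e W, h1, h2, h3, Matrix.add_mul, Matrix.mul_add, matInner, matInner, Matrix.mul_add,
    Matrix.trace_add, Matrix.smul_mul, Matrix.mul_smul, Matrix.mul_smul, Matrix.trace_smul,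
    smul_eq_mul, layerGrad]
  congr 2
  rw [← Matrix.mul_assoc, Matrix.trace_mul_comm, Matrix.mul_assoc,
    Matrix.mul_assoc, Matrix.trace_single_mul, ← Matrix.mul_assoc]
  simp

theorem contDiff_partialProd (k : ℕ) (h : k ≤ L) (a : Fin (d k)) (c : Fin (d 0)) :
    ContDiff ℝ 2 fun W : Params L d => partialProd W k h a c := by
  induction k with
  | zero => exact contDiff_const
  | succ k ih =>
    simp only [partialProd, Matrix.mul_apply]
    refine ContDiff.sum fun j _ => ContDiff.mul ?_ (ih _ j)
    simp only [layer, Matrix.of_apply]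
    fun_prop

theorem loss_one_eq (A : Matrix (Fin (d L)) (Fin (d 0)) ℝ) (b : ℝ) :
    loss (fun _ : Fin 1 => A) (fun _ => b) =
      fun W : Params L d => (matInner A (endToEnd W) - b) ^ 2 := by
  ext W; simp [loss]

theorem contDiff_loss_one (A : Matrix (Fin (d L)) (Fin (d 0)) ℝ) (b : ℝ) :
    ContDiff ℝ 2 (loss (fun _ : Fin 1 => A) (fun _ => b) : Params L d → ℝ) := by
  rw [loss_one_eq]
  refine (ContDiff.sub ?_ contDiff_const).pow 2
  simp only [matInner, Matrix.trace, Matrix.diag, Matrix.mul_apply]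
  exact ContDiff.sum fun j _ => ContDiff.sum fun p _ =>
    contDiff_const.mul (contDiff_partialProd L le_rfl p j)

theorem fderiv_fderiv_apply_self_of_sq {E : Type*} [NormedAddCommGroup E] [NormedSpace ℝ E]
    {f : E → ℝ} (hf : ContDiff ℝ 2 f) (x v : E) (α β : ℝ)
    (h : ∀ t : ℝ, f (x + t • v) = (α + t * β) ^ 2) :
    fderiv ℝ (fderiv ℝ f) x v v = 2 * β ^ 2 := by
  have hd : Differentiable ℝ f := hf.differentiable (by norm_num)
  have hd2 : Differentiable ℝ (fderiv ℝ f) :=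
    (hf.fderiv_right (m := 1) (by norm_num)).differentiable (by norm_num)
  have hline : ∀ t : ℝ, HasDerivAt (fun s : ℝ => x + s • v) v t := fun t => by
    simpa using ((hasDerivAt_id t).smul_const v).const_add x
  have h1 : ∀ t : ℝ, fderiv ℝ f (x + t • v) v = 2 * (α + t * β) * β := fun t => by
    have e1 := (hd (x + t • v)).hasFDerivAt.comp_hasDerivAt t (hline t)
    have e2 : HasDerivAt (fun s : ℝ => (α + s * β) ^ 2) (2 * (α + t * β) * β) t := by
      have := (((hasDerivAt_id t).mul_const β).const_add α).fun_pow 2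
      simpa using this
    have e3 : (f ∘ fun s : ℝ => x + s • v) = fun s : ℝ => (α + s * β) ^ 2 := funext h
    rw [e3] at e1
    exact e1.unique e2
  have e1 := (hd2 (x + (0 : ℝ) • v)).hasFDerivAt.comp_hasDerivAt 0 (hline 0)
  have e1' := e1.clm_apply (hasDerivAt_const (0 : ℝ) v)
  have e2 : HasDerivAt (fun s : ℝ => 2 * (α + s * β) * β) (2 * β ^ 2) 0 := by
    have := ((((hasDerivAt_id (0 : ℝ)).mul_const β).const_add α).const_mul 2).mul_const β
    convert! this using 1
    ring
  have e3 : (fun s : ℝ => ((fderiv ℝ f ∘ fun s : ℝ => x + s • v) s) v) =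
      fun s : ℝ => 2 * (α + s * β) * β := funext h1
  rw [e3] at e1'
  have := e1'.unique e2
  simpa using this

theorem trace_hessian_loss_one (A : Matrix (Fin (d L)) (Fin (d 0)) ℝ) (b : ℝ) (W : Params L d) :
    (hessian (loss (fun _ : Fin 1 => A) (fun _ => b)) W).trace =
      2 * ∑ i, frobSq (layerGrad A.transpose W i) := by
  have key : ∀ (i : Fin L) (a : Fin (d (i + 1))) (c : Fin (d i)),
      hessian (loss (fun _ : Fin 1 => A) (fun _ => b)) W ⟨i, (a, c)⟩ ⟨i, (a, c)⟩ =
        2 * layerGrad A.transpose W i c a ^ 2 := by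
    intro i a c
    rw [hessian, Matrix.of_apply, iteratedFDeriv_two_apply]
    refine fderiv_fderiv_apply_self_of_sq (contDiff_loss_one A b) W
      (EuclideanSpace.single ⟨i, (a, c)⟩ 1) (matInner A (endToEnd W) - b) _ fun t => ?_
    rw [loss_one_eq]
    simp only
    rw [matInner_endToEnd_add_smul_single]
    ring
  rw [Matrix.trace, Fintype.sum_sigma, Finset.mul_sum]
  refine Finset.sum_congr rfl fun i _ => ?_
  rw [Fintype.sum_prod_type, Finset.sum_comm, frobSq, Finset.mul_sum]
  refine Finset.sum_congr rfl fun c _ => ?_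
  rw [Finset.mul_sum]
  exact Finset.sum_congr rfl fun a _ => key i a c

end Network

theorem mul_pow_mul_eq_pow_mul_mul {m n : Type*} [Fintype m] [Fintype n] [DecidableEq m] [DecidableEq n]
    (B : Matrix m n ℝ) (M : Matrix n m ℝ) (k : ℕ) :
    B * (M * B) ^ k = (B * M) ^ k * B := by
  induction k with
  | zero => simp
  | succ k ih =>
    rw [pow_succ, ← Matrix.mul_assoc, ih, pow_succ]
    simp only [Matrix.mul_assoc]

/-! ### The lower bound -/

section Network

variable {L : ℕ} {d : ℕ → ℕ}

/-- The product of the transposed layer gradients from the `k`-th on. -/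
def gradProd (B : Matrix (Fin (d 0)) (Fin (d L)) ℝ) (W : Params L d) (k : ℕ) (h : k ≤ L) :
    Matrix (Fin (d k)) (Fin (d L)) ℝ :=
  Nat.decreasingInduction (motive := fun m _ => Matrix (Fin (d m)) (Fin (d L)) ℝ)
    (fun m hm Y => layerGrad B W ⟨m, hm⟩ * Y) 1 h

theorem gradProd_self (B : Matrix (Fin (d 0)) (Fin (d L)) ℝ) (W : Params L d) :
    gradProd B W L le_rfl = 1 :=
  Nat.decreasingInduction_self _ _

theorem gradProd_eq_mul (B : Matrix (Fin (d 0)) (Fin (d L)) ℝ) (W : Params L d)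
    (k : ℕ) (h : k < L) :
    gradProd B W k h.le = layerGrad B W ⟨k, h⟩ * gradProd B W (k + 1) h :=
  Nat.decreasingInduction_succ_left _ _ _ _

/-- The `k`-th gradient starts with `partialProd W k`, which completes `suffixProd W k` to the
end-to-end matrix: each step releases one factor `endToEnd W * B` and leaves the next suffix. -/
theorem suffixProd_mul_gradProd (B : Matrix (Fin (d 0)) (Fin (d L)) ℝ) (W : Params L d)
    (k : ℕ) (h : k ≤ L) :
    suffixProd W k h * gradProd B W k h = (endToEnd W * B) ^ (L - k) := by
  induction h using Nat.decreasingInduction with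
  | self => rw [suffixProd_self, gradProd_self, Nat.sub_self, pow_zero, Matrix.one_mul]
  | of_succ k hk ih =>
    have e : L - k = (L - (k + 1)) + 1 := by omega
    rw [e, pow_succ', ← ih, gradProd_eq_mul _ _ k hk, layerGrad,
      ← suffixProd_mul_partialProd W k hk.le]
    simp only [Matrix.mul_assoc]

theorem gradProd_zero (hL : 0 < L) (B : Matrix (Fin (d 0)) (Fin (d L)) ℝ) (W : Params L d) :
    gradProd B W 0 hL.le = (B * endToEnd W) ^ (L - 1) * B := by
  rw [gradProd_eq_mul B W 0 hL, layerGrad]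
  change (1 : Matrix _ _ ℝ) * B * suffixProd W (0 + 1) hL * gradProd B W (0 + 1) hL = _
  rw [Matrix.one_mul, Matrix.mul_assoc, suffixProd_mul_gradProd, mul_pow_mul_eq_pow_mul_mul]

theorem norm_toEuclideanLin_eq_singVal {m n : ℕ} (X : Matrix (Fin m) (Fin n) ℝ)
    (v : Fin n → EuclideanSpace ℝ (Fin n))
    (hv : ∀ i j, inner ℝ (Matrix.toEuclideanLin X (v i)) (Matrix.toEuclideanLin X (v j)) =
        if i = j then singVal X i ^ 2 else 0) (j : Fin n) :
    ‖gramSchmidt ℝ (fun i => Matrix.toEuclideanLin X (v i)) j‖ = singVal X j := by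
  rw [gramSchmidt_of_orthogonal]
  · have := hv j j
    rw [if_pos rfl, real_inner_self_eq_norm_sq] at this
    exact (sq_eq_sq₀ (norm_nonneg _) (singVal_nonneg _ _)).1 this
  · intro i j hij
    simp [hv, hij]

/-- The Schatten quasinorm of the product of the layer gradients is controlled by their Frobenius
norms. -/
theorem mul_sum_singVal_rpow_le (hL : 0 < L) (B : Matrix (Fin (d 0)) (Fin (d L)) ℝ)
    (W : Params L d) :
    (L : ℝ) * ∑ j, singVal ((B * endToEnd W) ^ (L - 1) * B) j ^ (2 / (L : ℝ)) ≤
      ∑ i, frobSq (layerGrad B W i) := by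
  set X := (B * endToEnd W) ^ (L - 1) * B with hX
  obtain ⟨v, hv⟩ := exists_singular_basis X
  -- `y k` are the singular vectors after the gradients of index at least `k`, `g` their
  -- Gram–Schmidt norms, and `τ` the expansion factors between levels.
  let y : ∀ k, k ≤ L → Fin (d L) → EuclideanSpace ℝ (Fin (d k)) := fun k h i =>
    Matrix.toEuclideanLin (gradProd B W k h) (v i)
  let g : Fin (d L) → ℕ → ℝ := fun j k => if h : k ≤ L then ‖gramSchmidt ℝ (y k h) j‖ else 0
  let τ : Fin (d L) → ℕ → ℝ := fun j k => if h : k < L then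
    ‖Matrix.toEuclideanLin (layerGrad B W ⟨k, h⟩) (gramSchmidtNormed ℝ (y (k + 1) h) j)‖ else 0
  have hτ0 : ∀ j k, 0 ≤ τ j k := fun j k => by
    simp only [τ]; split_ifs <;> positivity
  have hstep : ∀ j k, k < L → g j k ≤ τ j k * g j (k + 1) := by
    intro j k hk
    simp only [g, τ, dif_pos hk, dif_pos hk.le, dif_pos (Nat.succ_le_of_lt hk)]
    have hy : y k hk.le = fun i =>
        Matrix.toEuclideanLin (layerGrad B W ⟨k, hk⟩) (y (k + 1) hk i) := by
      funext i
      simp only [y, gradProd_eq_mul B W k hk, Matrix.toLpLin_apply, Matrix.mulVec_mulVec]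
    rw [hy]
    exact norm_gramSchmidt_map_le _ _ _
  have hg0 : ∀ j, g j 0 = singVal X j := by
    intro j
    simp only [g, y, dif_pos hL.le, gradProd_zero hL]
    exact norm_toEuclideanLin_eq_singVal X v hv j
  have hgL : ∀ j, g j L = 1 := by
    intro j
    have hyL : y L le_rfl = v := by
      funext i
      simp [y, gradProd_self, Matrix.toLpLin_apply]
    simp only [g, dif_pos (le_refl L), hyL]
    rw [gramSchmidt_of_orthogonal ℝ fun i k hik => v.orthonormal.2 hik]
    exact v.orthonormal.1 j
  have hj : ∀ j, (L : ℝ) * singVal X j ^ (2 / (L : ℝ)) ≤ ∑ k ∈ Finset.range L, τ j k ^ 2 := by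
    intro j
    refine rpow_two_div_prod_le hL (τ j) (singVal_nonneg X j) ?_
    have := le_prod_mul_of_le_mul_succ (g j) (τ j) (hτ0 j) (hstep j)
    rwa [hg0, hgL, mul_one] at this
  rw [Finset.mul_sum]
  refine (Finset.sum_le_sum fun j _ => hj j).trans ?_
  rw [Finset.sum_comm, ← Fin.sum_univ_eq_sum_range (fun k => ∑ j, τ j k ^ 2)]
  refine Finset.sum_le_sum fun k _ => ?_
  simp only [τ, dif_pos k.2]
  exact sum_norm_sq_gramSchmidtNormed_le _ _

end Network

/-! ### Splitting a chain into signal and noise -/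

open Matrix

/-- A composition `C1 * C ^ N * CL` of real matrices together with its right singular vectors
(the columns of `V`) and the `(N + 2)`-th roots `s` of its singular values. -/
structure SingularChain (N p q m : ℕ) where
  /-- the left factor -/
  C1 : Matrix (Fin p) (Fin m) ℝ
  /-- the repeated middle factor -/
  C : Matrix (Fin m) (Fin m) ℝ
  /-- the right factor -/
  CL : Matrix (Fin m) (Fin q) ℝ
  /-- the right singular vectors -/
  V : Matrix (Fin q) (Fin q) ℝ
  /-- the roots of the singular values -/
  s : Fin q → ℝ
  V_mul_transpose : V * Vᵀ = 1
  gram : Vᵀ * (C1 * C ^ N * CL)ᵀ * (C1 * C ^ N * CL) * V = diagonal fun j => s j ^ (2 * N + 4)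

namespace SingularChain

variable {N p q m : ℕ} (c : SingularChain N p q m)

/-- The composition of the chain. -/
def X : Matrix (Fin p) (Fin q) ℝ := c.C1 * c.C ^ N * c.CL

/-- The diagonal matrix of the roots of the singular values. -/
def S : Matrix (Fin q) (Fin q) ℝ := diagonal c.s

/-- The powers of the pseudoinverse of `S`. -/
def invS (e : ℕ) : Matrix (Fin q) (Fin q) ℝ := diagonal fun j => (c.s j)⁻¹ ^ e

/-- The projection onto the coordinates with a nonzero singular value. -/
def D : Matrix (Fin q) (Fin q) ℝ := diagonal fun j => (c.s j)⁻¹ * c.s j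

/-- The signal coordinates in the `k`-th intermediate space. -/
def a (k : ℕ) : Matrix (Fin q) (Fin m) ℝ := c.invS (k + N + 3) * (c.Vᵀ * c.Xᵀ * c.C1 * c.C ^ k)

/-- The signal vectors in the `k`-th intermediate space. -/
def b (k : ℕ) : Matrix (Fin m) (Fin q) ℝ := c.C ^ (N - k) * c.CL * c.V * c.invS (N + 1 - k)

/-- The projection onto the noise space along the signal space. -/
def noise (k : ℕ) : Matrix (Fin m) (Fin m) ℝ := 1 - c.b k * c.a k

/-- With `0⁻¹ = 0`, `invS e` is a power of the pseudoinverse only for `e > 0`; at `e = 0` it is the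
identity instead of `D`. -/
theorem D_mul_invS {e : ℕ} (he : 0 < e) : c.D * c.invS e = c.invS e := by
  rw [D, invS, diagonal_mul_diagonal]
  congr 1; funext j
  by_cases h : c.s j = 0
  · simp [h, he.ne']
  · rw [inv_mul_cancel₀ h, one_mul]

theorem invS_mul_D {e : ℕ} (he : 0 < e) : c.invS e * c.D = c.invS e := by
  rw [← c.D_mul_invS he, D, invS]
  simp only [diagonal_mul_diagonal]
  congr 1; funext j
  by_cases h : c.s j = 0
  · simp [h]
  · rw [inv_mul_cancel₀ h]; ring

theorem S_mul_invS {e : ℕ} (he : 0 < e) : c.S * c.invS (e + 1) = c.invS e := by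
  rw [S, invS, invS, diagonal_mul_diagonal]
  congr 1; funext j
  by_cases h : c.s j = 0
  · simp [h, he.ne']
  · rw [pow_succ', mul_inv_cancel_left₀ h]

theorem invS_mul_S {e : ℕ} (he : 0 < e) : c.invS (e + 1) * c.S = c.invS e := by
  rw [← c.S_mul_invS he, S, invS, diagonal_mul_diagonal, diagonal_mul_diagonal]
  congr 1; funext j; ring

theorem invS_mul_pow_mul_invS {e f g : ℕ} (h : e + f = g) (hg : 0 < g) :
    c.invS e * (diagonal fun j => c.s j ^ g) * c.invS f = c.D := by
  rw [D, invS, invS, diagonal_mul_diagonal, diagonal_mul_diagonal]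
  congr 1; funext j
  by_cases h0 : c.s j = 0
  · simp [h0, hg.ne']
  · rw [inv_mul_cancel₀ h0, mul_right_comm, ← pow_add, h, ← mul_pow, inv_mul_cancel₀ h0, one_pow]

theorem V_transpose_mul : c.Vᵀ * c.V = 1 := mul_eq_one_comm.1 c.V_mul_transpose

theorem gram_X : c.Vᵀ * c.Xᵀ * c.X * c.V = diagonal fun j => c.s j ^ (2 * N + 4) := c.gram

theorem transpose_mul_X : c.Vᵀ * c.Xᵀ * c.X = (diagonal fun j => c.s j ^ (2 * N + 4)) * c.Vᵀ := by
  rw [← c.gram_X, Matrix.mul_assoc _ c.V, c.V_mul_transpose, Matrix.mul_one]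

/-- The columns of `X * V` with zero singular value have zero Gram matrix, hence vanish. -/
theorem X_mul_V_mul_D : c.X * c.V * c.D = c.X * c.V := by
  have h : (c.X * c.V * (1 - c.D))ᴴ * (c.X * c.V * (1 - c.D)) = 0 := by
    have e : (c.X * c.V * (1 - c.D))ᴴ * (c.X * c.V * (1 - c.D)) =
        (1 - c.D)ᵀ * ((c.Vᵀ * c.Xᵀ * c.X * c.V) * (1 - c.D)) := by
      simp only [conjTranspose_eq_transpose_of_trivial, transpose_mul, Matrix.mul_assoc]
    rw [e, c.gram_X, D, ← diagonal_one, diagonal_sub, diagonal_mul_diagonal]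
    have : (fun i => c.s i ^ (2 * N + 4) * (1 - (c.s i)⁻¹ * c.s i)) = fun _ => 0 := by
      funext j
      by_cases h : c.s j = 0
      · simp [h]
      · simp [h]
    rw [this, diagonal_zero, Matrix.mul_zero]
  rw [conjTranspose_mul_self_eq_zero, Matrix.mul_sub, Matrix.mul_one, sub_eq_zero] at h
  exact h.symm

theorem D_transpose : c.Dᵀ = c.D := diagonal_transpose _

theorem S_transpose : c.Sᵀ = c.S := diagonal_transpose _

theorem invS_transpose (e : ℕ) : (c.invS e)ᵀ = c.invS e := diagonal_transpose _

theorem D_mul_transpose_X : c.D * (c.Vᵀ * c.Xᵀ) = c.Vᵀ * c.Xᵀ := by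
  have := congrArg transpose c.X_mul_V_mul_D
  simpa only [transpose_mul, D_transpose] using this

theorem D_mul_a (k : ℕ) : c.D * c.a k = c.a k := by
  rw [a, ← Matrix.mul_assoc, c.D_mul_invS (by omega)]

theorem b_mul_D {k : ℕ} (hk : k ≤ N) : c.b k * c.D = c.b k := by
  rw [b, Matrix.mul_assoc _ _ c.D, c.invS_mul_D (by omega)]

theorem pow_split {k : ℕ} (hk : k ≤ N) : c.C1 * c.C ^ k * (c.C ^ (N - k) * c.CL) = c.X := by
  rw [X, ← Matrix.mul_assoc, Matrix.mul_assoc c.C1, ← pow_add, Nat.add_sub_cancel' hk]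

theorem a_mul {k : ℕ} (hk : k ≤ N) : c.a k * (c.C ^ (N - k) * c.CL) =
    c.invS (k + N + 3) * (diagonal fun j => c.s j ^ (2 * N + 4)) * c.Vᵀ := by
  have e : c.Vᵀ * c.Xᵀ * c.X = c.Vᵀ * c.Xᵀ * (c.C1 * c.C ^ k * (c.C ^ (N - k) * c.CL)) := by
    rw [c.pow_split hk]
  rw [Matrix.mul_assoc (c.invS _), ← c.transpose_mul_X, e, a]
  simp only [Matrix.mul_assoc]

/-- The exponents `k + N + 3` and `N + 1 - k` add up to the `2 * N + 4` of the Gram matrix. Thus `b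
k * a k` is idempotent. -/
theorem a_mul_b {k : ℕ} (hk : k ≤ N) : c.a k * c.b k = c.D := by
  rw [b, ← Matrix.mul_assoc, ← Matrix.mul_assoc, c.a_mul hk, Matrix.mul_assoc _ _ c.V,
    c.V_transpose_mul, Matrix.mul_one, c.invS_mul_pow_mul_invS (by omega) (by omega)]

theorem a_mul_noise {k : ℕ} (hk : k ≤ N) : c.a k * c.noise k = 0 := by
  rw [noise, Matrix.mul_sub, Matrix.mul_one, ← Matrix.mul_assoc, c.a_mul_b hk, c.D_mul_a, sub_self]

theorem noise_mul_b {k : ℕ} (hk : k ≤ N) : c.noise k * c.b k = 0 := by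
  rw [noise, Matrix.sub_mul, Matrix.one_mul, Matrix.mul_assoc, c.a_mul_b hk, c.b_mul_D hk, sub_self]

theorem a_mul_C (k : ℕ) : c.a k * c.C = c.S * c.a (k + 1) := by
  have e : k + 1 + N + 3 = (k + N + 3) + 1 := by ring
  rw [a, a, e, ← Matrix.mul_assoc c.S, c.S_mul_invS (by omega), pow_succ]
  simp only [Matrix.mul_assoc]

theorem C_mul_b {k : ℕ} (hk : k < N) : c.C * c.b (k + 1) = c.b k * c.S := by
  obtain ⟨l, rfl⟩ := Nat.exists_eq_add_of_lt hk
  have e1 : k + l + 1 - (k + 1) = l := by omega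
  have e2 : k + l + 1 - k = l + 1 := by omega
  have e3 : k + l + 1 + 1 - (k + 1) = l + 1 := by omega
  have e4 : k + l + 1 + 1 - k = l + 1 + 1 := by omega
  rw [b, b, e1, e2, e3, e4, Matrix.mul_assoc _ _ c.S, c.invS_mul_S (by omega), pow_succ']
  simp only [Matrix.mul_assoc]

/-- By `a_mul_C` and `C_mul_b`, `C` scales the signal by `S` both in coordinates and on vectors, so
it intertwines the signal projections. -/
theorem noise_mul_C {k : ℕ} (hk : k < N) : c.noise k * c.C = c.C * c.noise (k + 1) := by
  rw [noise, noise, Matrix.sub_mul, Matrix.mul_sub, Matrix.mul_assoc, c.a_mul_C,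
    ← Matrix.mul_assoc, ← c.C_mul_b hk]
  simp [Matrix.mul_assoc]

theorem C1_mul_b : c.C1 * c.b 0 = c.X * c.V * c.invS (N + 1) := by
  rw [b, X]; simp [Matrix.mul_assoc]

theorem gram_C1_mul_b : (c.C1 * c.b 0)ᵀ * (c.C1 * c.b 0) = c.S * c.S := by
  have e : (c.C1 * c.b 0)ᵀ * (c.C1 * c.b 0) =
      c.invS (N + 1) * (c.Vᵀ * c.Xᵀ * c.X * c.V) * c.invS (N + 1) := by
    rw [C1_mul_b, transpose_mul, transpose_mul, invS_transpose]
    simp only [Matrix.mul_assoc]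
  rw [e, c.gram_X, invS, S, diagonal_mul_diagonal, diagonal_mul_diagonal, diagonal_mul_diagonal]
  congr 1; funext j
  by_cases h : c.s j = 0
  · simp [h]
  · simp only [inv_pow]
    field_simp
    ring

theorem transpose_X_mul_C1_mul_noise : c.Vᵀ * c.Xᵀ * c.C1 * c.noise 0 = 0 := by
  have h : c.Vᵀ * c.Xᵀ * c.C1 = (diagonal fun j => c.s j ^ (N + 3)) * c.a 0 := by
    have e : (diagonal fun j => c.s j ^ (N + 3)) * c.invS (0 + N + 3) = c.D := by
      rw [D, invS, diagonal_mul_diagonal]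
      congr 1; funext j
      by_cases h : c.s j = 0
      · simp [h]
      · simp [h]
    rw [a, ← Matrix.mul_assoc, e, pow_zero, Matrix.mul_one, ← Matrix.mul_assoc,
      D_mul_transpose_X]
  rw [h, Matrix.mul_assoc, c.a_mul_noise (Nat.zero_le _), Matrix.mul_zero]

/-- `C1` sends noise orthogonally to the signal, by `transpose_X_mul_C1_mul_noise`, so the cross
terms vanish. -/
theorem gram_C1 : c.C1ᵀ * c.C1 =
    (c.a 0)ᵀ * (c.S * c.S) * c.a 0 + (c.C1 * c.noise 0)ᵀ * (c.C1 * c.noise 0) := by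
  have h0 : (c.C1 * c.b 0)ᵀ * (c.C1 * c.noise 0) = 0 := by
    have : (c.C1 * c.b 0)ᵀ * (c.C1 * c.noise 0) =
        c.invS (N + 1) * (c.Vᵀ * c.Xᵀ * c.C1 * c.noise 0) := by
      rw [C1_mul_b, transpose_mul, transpose_mul, invS_transpose]
      simp only [Matrix.mul_assoc]
    rw [this, transpose_X_mul_C1_mul_noise, Matrix.mul_zero]
  have h0' : (c.C1 * c.noise 0)ᵀ * (c.C1 * c.b 0) = 0 := by
    have := congrArg transpose h0
    simpa only [transpose_mul, transpose_transpose, transpose_zero, Matrix.mul_assoc] using this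
  have e : c.C1 = c.C1 * c.b 0 * c.a 0 + c.C1 * c.noise 0 := by
    rw [noise, Matrix.mul_sub, Matrix.mul_one, Matrix.mul_assoc, add_sub_cancel]
  conv_lhs => rw [e]
  rw [transpose_add, transpose_mul (c.C1 * c.b 0), Matrix.add_mul, Matrix.mul_add, Matrix.mul_add,
    Matrix.mul_assoc (c.a 0)ᵀ _ (c.C1 * c.noise 0), h0, Matrix.mul_zero, add_zero,
    ← Matrix.mul_assoc (c.C1 * c.noise 0)ᵀ, h0', Matrix.zero_mul, zero_add, ← gram_C1_mul_b]
  simp only [Matrix.mul_assoc]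

/-- The part of the right factor that the chain annihilates. -/
def lastNoise : Matrix (Fin m) (Fin q) ℝ := c.CL * (c.V * (1 - c.D) * c.Vᵀ)

theorem a_mul_CL : c.a N * c.CL = c.S * c.Vᵀ := by
  have h := c.a_mul (le_refl N)
  rw [Nat.sub_self, pow_zero, Matrix.one_mul] at h
  rw [h, invS, diagonal_mul_diagonal, S]
  congr 2; funext j
  by_cases h : c.s j = 0
  · simp [h]
  · simp only [inv_pow]
    field_simp
    ring

theorem noise_mul_CL : c.noise N * c.CL = c.lastNoise := by
  have e : c.invS 1 * c.S = c.D := by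
    rw [invS, S, D, diagonal_mul_diagonal]; simp
  rw [noise, Matrix.sub_mul, Matrix.one_mul, Matrix.mul_assoc, a_mul_CL, b, Nat.sub_self, pow_zero,
    Matrix.one_mul, Nat.add_sub_cancel_left, lastNoise, Matrix.mul_sub, Matrix.sub_mul,
    Matrix.mul_sub, Matrix.mul_one, c.V_mul_transpose, Matrix.mul_one, ← e]
  simp only [Matrix.mul_assoc]

theorem X_mul_noise : c.C1 * c.C ^ N * c.lastNoise = 0 := by
  have : c.C1 * c.C ^ N * c.lastNoise = (c.X * c.V * (1 - c.D)) * c.Vᵀ := by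
    rw [lastNoise, X]; simp only [Matrix.mul_assoc]
  rw [this, Matrix.mul_sub, Matrix.mul_one, X_mul_V_mul_D, sub_self, Matrix.zero_mul]

/-- The Gram matrix of the intermediate inner product: signal and noise are orthogonal, the signal
vectors are orthonormal, and `h` is used on the noise space. -/
def H (h : ℕ → Matrix (Fin m) (Fin m) ℝ) (k : ℕ) : Matrix (Fin m) (Fin m) ℝ :=
  (c.a k)ᵀ * c.a k + (c.noise k)ᵀ * h k * c.noise k

variable {h : ℕ → Matrix (Fin m) (Fin m) ℝ}

/-- If both `a k` and `noise k` kill `x`, then `x = b k (a k x) + noise k x = 0`. -/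
theorem H_posDef {k : ℕ} (hk : (h k).PosDef) : (c.H h k).PosDef := by
  have h1 : ((c.a k)ᵀ * c.a k).PosSemidef := by
    simpa using posSemidef_conjTranspose_mul_self (c.a k)
  have h2 : ((c.noise k)ᵀ * h k * c.noise k).PosSemidef := by
    simpa using hk.posSemidef.conjTranspose_mul_mul_same (c.noise k)
  rw [posDef_iff_dotProduct_mulVec]
  refine ⟨(h1.add h2).1, fun x hx => ?_⟩
  have e1 : star x ⬝ᵥ ((c.a k)ᵀ * c.a k) *ᵥ x = (c.a k *ᵥ x) ⬝ᵥ (c.a k *ᵥ x) := by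
    rw [← mulVec_mulVec, dotProduct_mulVec, vecMul_transpose]; simp
  have e2 : star x ⬝ᵥ ((c.noise k)ᵀ * h k * c.noise k) *ᵥ x =
      star (c.noise k *ᵥ x) ⬝ᵥ (h k *ᵥ (c.noise k *ᵥ x)) := by
    rw [Matrix.mul_assoc, ← mulVec_mulVec, dotProduct_mulVec, vecMul_transpose, ← mulVec_mulVec]
    simp
  rw [H, add_mulVec, dotProduct_add, e1, e2]
  have n1 : 0 ≤ (c.a k *ᵥ x) ⬝ᵥ (c.a k *ᵥ x) := by
    simpa using dotProduct_star_self_nonneg (c.a k *ᵥ x)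
  by_cases h0 : c.noise k *ᵥ x = 0
  · rw [h0]
    have hax : c.a k *ᵥ x ≠ 0 := by
      intro ha
      apply hx
      rw [noise, sub_mulVec, one_mulVec, ← mulVec_mulVec, ha, mulVec_zero, sub_zero] at h0
      exact h0
    have : (c.a k *ᵥ x) ⬝ᵥ (c.a k *ᵥ x) ≠ 0 := fun h => hax (dotProduct_self_eq_zero.1 h)
    simpa using lt_of_le_of_ne n1 this.symm
  · have := (posDef_iff_dotProduct_mulVec.1 hk).2 h0
    linarith

theorem H_mul_b {k : ℕ} (hk : k ≤ N) : c.H h k * c.b k = (c.a k)ᵀ := by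
  rw [H, Matrix.add_mul, Matrix.mul_assoc, c.a_mul_b hk, Matrix.mul_assoc _ (c.noise k),
    c.noise_mul_b hk, Matrix.mul_zero, add_zero]
  have := congrArg transpose (c.D_mul_a k)
  rwa [transpose_mul, D_transpose] at this

theorem trace_S_mul_S_mul_D : (c.S * c.S * c.D).trace = ∑ j, c.s j ^ 2 := by
  rw [S, D, diagonal_mul_diagonal, diagonal_mul_diagonal, trace_diagonal]
  refine Finset.sum_congr rfl fun j _ => ?_
  by_cases h : c.s j = 0
  · simp [h]
  · field_simp

/-- `H_mul_b` gives `b k = (H k)⁻¹ (a k)ᵀ`, so by cyclicity the trace is that of `S² (a k) (b k) =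
S² D`, whatever `h` is. -/
theorem trace_signal {k : ℕ} (hk : k ≤ N) (hp : (h k).PosDef) :
    ((c.a k)ᵀ * (c.S * c.S) * c.a k * (c.H h k)⁻¹).trace = ∑ j, c.s j ^ 2 := by
  have hu : IsUnit (c.H h k).det := (isUnit_iff_isUnit_det _).1 (c.H_posDef hp).isUnit
  rw [← trace_S_mul_S_mul_D, ← c.a_mul_b hk]
  have : c.b k = (c.H h k)⁻¹ * (c.a k)ᵀ := by
    rw [← c.H_mul_b (h := h) hk, ← Matrix.mul_assoc, nonsing_inv_mul _ hu, Matrix.one_mul]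
  rw [this, Matrix.mul_assoc, Matrix.mul_assoc, trace_mul_comm]
  simp only [Matrix.mul_assoc]

theorem cost_first (hp : (h 0).PosDef) : (c.C1ᵀ * c.C1 * (c.H h 0)⁻¹).trace =
    ∑ j, c.s j ^ 2 +
      ((c.noise 0)ᵀ * (c.C1ᵀ * c.C1) * c.noise 0 * (c.H h 0)⁻¹).trace := by
  conv_lhs => rw [gram_C1]
  rw [Matrix.add_mul, trace_add, c.trace_signal (Nat.zero_le N) hp, transpose_mul]
  simp only [Matrix.mul_assoc]

theorem cost_middle {k : ℕ} (hk : k < N) (hp : (h (k + 1)).PosDef) :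
    (c.Cᵀ * c.H h k * c.C * (c.H h (k + 1))⁻¹).trace = ∑ j, c.s j ^ 2 +
      ((c.noise (k + 1))ᵀ * (c.Cᵀ * h k * c.C) * c.noise (k + 1) * (c.H h (k + 1))⁻¹).trace := by
  have e : c.Cᵀ * c.H h k * c.C = (c.a k * c.C)ᵀ * (c.a k * c.C) +
      (c.noise k * c.C)ᵀ * h k * (c.noise k * c.C) := by
    rw [H, Matrix.mul_add, Matrix.add_mul, transpose_mul, transpose_mul]
    simp only [Matrix.mul_assoc]
  have e1 : (c.S * c.a (k + 1))ᵀ * (c.S * c.a (k + 1)) =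
      (c.a (k + 1))ᵀ * (c.S * c.S) * c.a (k + 1) := by
    rw [transpose_mul, S_transpose]; simp only [Matrix.mul_assoc]
  rw [e, c.a_mul_C, c.noise_mul_C hk, Matrix.add_mul, trace_add, e1, c.trace_signal hk hp,
    transpose_mul]
  simp only [Matrix.mul_assoc]

theorem cost_last : (c.CLᵀ * c.H h N * c.CL).trace = ∑ j, c.s j ^ 2 +
      (c.lastNoiseᵀ * h N * c.lastNoise).trace := by
  have e : c.CLᵀ * c.H h N * c.CL = (c.a N * c.CL)ᵀ * (c.a N * c.CL) +
      (c.noise N * c.CL)ᵀ * h N * (c.noise N * c.CL) := by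
    rw [H, Matrix.mul_add, Matrix.add_mul, transpose_mul, transpose_mul]
    simp only [Matrix.mul_assoc]
  rw [e, a_mul_CL, noise_mul_CL, trace_add]
  congr 1
  rw [transpose_mul, transpose_transpose, S_transpose, Matrix.mul_assoc, trace_mul_comm,
    Matrix.mul_assoc, Matrix.mul_assoc, c.V_transpose_mul, Matrix.mul_one, S,
    diagonal_mul_diagonal, trace_diagonal]
  simp only [sq]

/-- The total cost of the intermediate inner products `H 0, …, H N`. -/
def cost (H : ℕ → Matrix (Fin m) (Fin m) ℝ) : ℝ :=
  (c.C1ᵀ * c.C1 * (H 0)⁻¹).trace +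
    ∑ k ∈ Finset.range N, (c.Cᵀ * H k * c.C * (H (k + 1))⁻¹).trace +
    (c.CLᵀ * H N * c.CL).trace

end SingularChain

/-! ### Positive semidefinite matrices and rank conditions -/

open scoped MatrixOrder in
theorem PosSemidef.exists_eq_transpose_mul_self {m : Type*} [Fintype m] [DecidableEq m]
    {P : Matrix m m ℝ} (hP : P.PosSemidef) : ∃ Q : Matrix m m ℝ, P = Qᵀ * Q := by
  obtain ⟨Q, hQ⟩ := CStarAlgebra.nonneg_iff_eq_star_mul_self.mp hP.nonneg
  exact ⟨Q, by rw [hQ, star_eq_conjTranspose, conjTranspose_eq_transpose_of_trivial]⟩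

theorem PosSemidef.trace_mul_nonneg {m : Type*} [Fintype m] [DecidableEq m]
    {P Q : Matrix m m ℝ} (hP : P.PosSemidef) (hQ : Q.PosSemidef) : 0 ≤ (P * Q).trace := by
  obtain ⟨R, rfl⟩ := PosSemidef.exists_eq_transpose_mul_self hQ
  rw [← Matrix.mul_assoc, trace_mul_comm, ← Matrix.mul_assoc]
  have := (hP.mul_mul_conjTranspose_same R).trace_nonneg
  simpa using this

/-- The column space of `Y * Z` lies in that of `Y`, and equal dimensions force equality. -/
theorem exists_eq_mul_mul_of_rank_le {p q r : Type*} [Fintype p] [Fintype q] [Fintype r]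
    [DecidableEq q] [DecidableEq r] {Y : Matrix p q ℝ} {Z : Matrix q r ℝ}
    (h : Y.rank ≤ (Y * Z).rank) : ∃ U : Matrix r q ℝ, Y = Y * Z * U := by
  have hle : LinearMap.range (Y * Z).mulVecLin ≤ LinearMap.range Y.mulVecLin := by
    rw [mulVecLin_mul]; exact LinearMap.range_comp_le_range _ _
  have heq := Submodule.eq_of_le_of_finrank_le hle h
  have hcol : ∀ j, ∃ u, (Y * Z) *ᵥ u = Y *ᵥ Pi.single j 1 := fun j => by
    have : Y *ᵥ Pi.single j 1 ∈ LinearMap.range Y.mulVecLin := ⟨Pi.single j 1, rfl⟩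
    rw [← heq] at this
    exact this
  choose u hu using hcol
  refine ⟨(Matrix.of u)ᵀ, ?_⟩
  ext i j
  have := congrFun (hu j) i
  rw [mulVec_single_one] at this
  rw [Matrix.mul_apply]
  exact this.symm

theorem exists_eq_mul_mul_of_rank_le' {p q r : Type*} [Fintype p] [Fintype q] [Fintype r]
    [DecidableEq q] [DecidableEq r] [DecidableEq p] {Y : Matrix p q ℝ} {Z : Matrix r p ℝ}
    (h : Y.rank ≤ (Z * Y).rank) : ∃ U : Matrix p r ℝ, Y = U * (Z * Y) := by
  have h' : Yᵀ.rank ≤ (Yᵀ * Zᵀ).rank := by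
    rwa [← transpose_mul, rank_transpose, rank_transpose]
  obtain ⟨U, hU⟩ := exists_eq_mul_mul_of_rank_le h'
  refine ⟨Uᵀ, ?_⟩
  have := congrArg transpose hU
  simpa only [transpose_mul, transpose_transpose] using this

/-! ### Making the noise cheap, or zero -/

namespace SingularChain

variable {N p q m : ℕ} (c : SingularChain N p q m) {h : ℕ → Matrix (Fin m) (Fin m) ℝ}

/-- `δ H - noiseᵀ κ noise` is positive semidefinite, so the trace is at most `δ tr (H H⁻¹) = δ m`.
-/
theorem trace_noise_le {k : ℕ} (hp : (h k).PosDef) {κ : Matrix (Fin m) (Fin m) ℝ} {δ : ℝ}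
    (hδ : 0 ≤ δ) (hκ : (δ • h k - κ).PosSemidef) :
    ((c.noise k)ᵀ * κ * c.noise k * (c.H h k)⁻¹).trace ≤ δ * m := by
  have hH := c.H_posDef hp
  have hu : IsUnit (c.H h k).det := (isUnit_iff_isUnit_det _).1 hH.isUnit
  have h1 : (δ • ((c.a k)ᵀ * c.a k)).PosSemidef := by
    have := posSemidef_conjTranspose_mul_self (c.a k)
    rw [conjTranspose_eq_transpose_of_trivial] at this
    exact this.smul hδ
  have h2 := hκ.conjTranspose_mul_mul_same (c.noise k)
  rw [conjTranspose_eq_transpose_of_trivial] at h2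
  have e : δ • ((c.a k)ᵀ * c.a k) + (c.noise k)ᵀ * (δ • h k - κ) * c.noise k =
      δ • c.H h k - (c.noise k)ᵀ * κ * c.noise k := by
    rw [H, smul_add, Matrix.mul_sub, Matrix.sub_mul, Matrix.mul_smul, Matrix.smul_mul]
    abel
  have h3 := PosSemidef.trace_mul_nonneg (h1.add h2) hH.posSemidef.inv
  rw [e, Matrix.sub_mul, trace_sub, Matrix.smul_mul, mul_nonsing_inv _ hu, trace_smul,
    trace_one] at h3
  simpa using h3

/-- Gram matrices making the chain contract the noise by the factor `δ`. -/
def contractGram (δ μ : ℝ) : ℕ → Matrix (Fin m) (Fin m) ℝ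
  | 0 => δ⁻¹ • (c.C1ᵀ * c.C1 + μ • 1)
  | k + 1 => δ⁻¹ • (c.Cᵀ * contractGram δ μ k * c.C + μ • 1)

theorem contractGram_posDef {δ μ : ℝ} (hδ : 0 < δ) (hμ : 0 < μ) (k : ℕ) :
    (c.contractGram δ μ k).PosDef := by
  induction k with
  | zero =>
    refine PosDef.smul ?_ (inv_pos.2 hδ)
    refine PosDef.posSemidef_add ?_ (PosDef.one.smul hμ)
    simpa using posSemidef_conjTranspose_mul_self c.C1
  | succ k ih =>
    refine PosDef.smul ?_ (inv_pos.2 hδ)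
    refine PosDef.posSemidef_add ?_ (PosDef.one.smul hμ)
    simpa using ih.posSemidef.conjTranspose_mul_mul_same c.C

theorem contractGram_zero_right (δ : ℝ) (k : ℕ) : c.contractGram δ 0 k =
    (δ⁻¹) ^ (k + 1) • ((c.C1 * c.C ^ k)ᵀ * (c.C1 * c.C ^ k)) := by
  induction k with
  | zero => simp [contractGram]
  | succ k ih =>
    rw [contractGram, ih, zero_smul, add_zero, Matrix.mul_smul, Matrix.smul_mul, smul_smul,
      ← pow_succ', pow_succ c.C, transpose_mul, transpose_mul, transpose_mul]
    simp only [Matrix.mul_assoc]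

theorem continuous_contractGram (δ : ℝ) (k : ℕ) :
    Continuous fun μ : ℝ => c.contractGram δ μ k := by
  induction k with
  | zero => simp only [contractGram]; fun_prop
  | succ k ih => simp only [contractGram]; fun_prop

/-- At `μ = 0` the form is a multiple of the Gram matrix of `C1 * C ^ N`, which annihilates
`lastNoise`. Continuity allows a small `μ > 0`, needed for definiteness. -/
theorem exists_trace_lastNoise_lt {δ : ℝ} (hδ : 0 < δ) :
    ∃ μ > 0, (c.lastNoiseᵀ * c.contractGram δ μ N * c.lastNoise).trace < δ := by
  have hc : Continuous fun μ : ℝ => (c.lastNoiseᵀ * c.contractGram δ μ N * c.lastNoise).trace := by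
    have := c.continuous_contractGram δ N
    exact ((continuous_const.matrix_mul this).matrix_mul continuous_const).matrix_trace
  have h0 : (c.lastNoiseᵀ * c.contractGram δ 0 N * c.lastNoise).trace < δ := by
    rw [contractGram_zero_right, Matrix.mul_smul, Matrix.smul_mul, Matrix.mul_assoc,
      Matrix.mul_assoc, X_mul_noise]
    simpa using hδ
  have hev := (hc.tendsto 0).eventually (gt_mem_nhds h0)
  obtain ⟨r, hr, hball⟩ := Metric.eventually_nhds_iff.1 hev
  refine ⟨r / 2, by positivity, hball ?_⟩
  rw [Real.dist_eq, sub_zero, abs_of_pos (by positivity)]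
  linarith

theorem exists_cost_le {ε : ℝ} (hε : 0 < ε) : ∃ H : ℕ → Matrix (Fin m) (Fin m) ℝ,
    (∀ k, (H k).PosDef) ∧ c.cost H ≤ (N + 2 : ℕ) * ∑ j, c.s j ^ 2 + ε := by
  -- Error budget: `N + 1` noise terms of at most `δ m` each, and a last one below `δ`.
  set δ := ε / ((N + 1) * m + 1) with hδdef
  have hδ : 0 < δ := by positivity
  obtain ⟨μ, hμ, hlast⟩ := c.exists_trace_lastNoise_lt hδ
  set h := c.contractGram δ μ with hh
  have hp : ∀ k, (h k).PosDef := c.contractGram_posDef hδ hμ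
  have hμ1 : (μ • (1 : Matrix (Fin m) (Fin m) ℝ)).PosSemidef := PosSemidef.one.smul hμ.le
  refine ⟨c.H h, fun k => c.H_posDef (hp k), ?_⟩
  have h1 : (c.C1ᵀ * c.C1 * (c.H h 0)⁻¹).trace ≤ ∑ j, c.s j ^ 2 + δ * m := by
    rw [c.cost_first (hp 0)]
    refine add_le_add_right (c.trace_noise_le (hp 0) hδ.le ?_) _
    rw [hh, contractGram, smul_inv_smul₀ hδ.ne', add_sub_cancel_left]
    exact hμ1
  have h2 : ∀ k ∈ Finset.range N, (c.Cᵀ * c.H h k * c.C * (c.H h (k + 1))⁻¹).trace ≤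
      ∑ j, c.s j ^ 2 + δ * m := by
    intro k hk
    rw [c.cost_middle (Finset.mem_range.1 hk) (hp _)]
    refine add_le_add_right (c.trace_noise_le (hp _) hδ.le ?_) _
    rw [hh, contractGram, smul_inv_smul₀ hδ.ne', add_sub_cancel_left]
    exact hμ1
  have h3 : (c.CLᵀ * c.H h N * c.CL).trace ≤ ∑ j, c.s j ^ 2 + δ := by
    rw [cost_last]
    exact add_le_add_right hlast.le _
  have h4 := Finset.sum_le_sum h2
  rw [Finset.sum_const, Finset.card_range, nsmul_eq_mul] at h4
  have h5 : δ * ((N + 1) * m + 1) = ε := by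
    rw [hδdef]; field_simp
  rw [cost]
  push_cast
  linarith

theorem noise_mul_pow {k l : ℕ} (h : k + l ≤ N) :
    c.noise k * c.C ^ l = c.C ^ l * c.noise (k + l) := by
  induction l with
  | zero => simp
  | succ l ih =>
    rw [pow_succ, ← Matrix.mul_assoc, ih (by omega), Matrix.mul_assoc,
      c.noise_mul_C (k := k + l) (by omega), ← Matrix.mul_assoc, add_assoc]

theorem lastNoise_eq_zero (hL : c.CL.rank ≤ c.X.rank) : c.lastNoise = 0 := by
  obtain ⟨U, hU⟩ := exists_eq_mul_mul_of_rank_le' (Y := c.CL) (Z := c.C1 * c.C ^ N) hL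
  rw [lastNoise, hU, Matrix.mul_assoc, Matrix.mul_assoc (c.C1 * c.C ^ N)]
  have := c.X_mul_noise
  rw [lastNoise] at this
  rw [this, Matrix.mul_zero]

/-- The rank condition gives `C1 = X U`, while `Xᵀ C1 noise = 0`; hence `C1 noise` has zero Gram
matrix. -/
theorem C1_mul_noise_eq_zero (h1 : c.C1.rank ≤ c.X.rank) : c.C1 * c.noise 0 = 0 := by
  obtain ⟨U, hU⟩ := exists_eq_mul_mul_of_rank_le (Y := c.C1) (Z := c.C ^ N * c.CL)
    (by rw [← Matrix.mul_assoc]; exact h1)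
  rw [← Matrix.mul_assoc] at hU
  change c.C1 = c.X * U at hU
  have hX : c.Xᵀ * (c.C1 * c.noise 0) = 0 := by
    have := congrArg (c.V * ·) c.transpose_X_mul_C1_mul_noise
    simp only [Matrix.mul_zero, ← Matrix.mul_assoc, c.V_mul_transpose, Matrix.one_mul] at this
    rwa [← Matrix.mul_assoc]
  rw [← conjTranspose_mul_self_eq_zero, conjTranspose_eq_transpose_of_trivial]
  conv_lhs => enter [1, 1, 1]; rw [hU]
  rw [transpose_mul, transpose_mul, Matrix.mul_assoc, Matrix.mul_assoc, hX, Matrix.mul_zero,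
    Matrix.mul_zero]

/-- The rank condition makes `C` factor through `C ^ (N - k) * CL` on the left; moving `noise k`
across that product turns it into `lastNoise`, which is zero. -/
theorem C_mul_noise_eq_zero (hC : c.C.rank ≤ c.X.rank) (hL : c.CL.rank ≤ c.X.rank) {k : ℕ}
    (hk : k < N) : c.C * c.noise (k + 1) = 0 := by
  obtain ⟨l, hl⟩ := Nat.exists_eq_add_of_lt hk
  have hr : c.C.rank ≤ (c.C * (c.C ^ l * c.CL)).rank := by
    refine hC.trans ?_
    have e : c.X = (c.C1 * c.C ^ k) * (c.C * (c.C ^ l * c.CL)) := by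
      have e' : c.C ^ N = c.C ^ k * (c.C * c.C ^ l) := by
        rw [← pow_succ', ← pow_add]
        exact congrArg (c.C ^ ·) (hl.trans (add_assoc _ _ _))
      rw [X, e']
      simp only [Matrix.mul_assoc]
    rw [e]
    exact rank_mul_le_right _ _
  obtain ⟨U, hU⟩ := exists_eq_mul_mul_of_rank_le hr
  have h0 : c.noise k * (c.C * (c.C ^ l * c.CL)) = 0 := by
    rw [← Matrix.mul_assoc c.C, ← pow_succ', ← Matrix.mul_assoc, c.noise_mul_pow (by omega),
      Matrix.mul_assoc, ← add_assoc, ← hl, noise_mul_CL, c.lastNoise_eq_zero hL, Matrix.mul_zero]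
  rw [← c.noise_mul_C hk, hU, ← Matrix.mul_assoc, h0, Matrix.zero_mul]

theorem exists_cost_le_of_rank_le (h1 : c.C1.rank ≤ c.X.rank) (hC : c.C.rank ≤ c.X.rank)
    (hL : c.CL.rank ≤ c.X.rank) : ∃ H : ℕ → Matrix (Fin m) (Fin m) ℝ,
      (∀ k, (H k).PosDef) ∧ c.cost H ≤ (N + 2 : ℕ) * ∑ j, c.s j ^ 2 := by
  -- The noise terms vanish, so any positive definite choice would do.
  set h : ℕ → Matrix (Fin m) (Fin m) ℝ := fun _ => 1
  have hp : ∀ k, (h k).PosDef := fun _ => PosDef.one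
  refine ⟨c.H h, fun k => c.H_posDef (hp k), ?_⟩
  have e1 : (c.C1ᵀ * c.C1 * (c.H h 0)⁻¹).trace = ∑ j, c.s j ^ 2 := by
    rw [c.cost_first (hp 0), Matrix.mul_assoc _ _ (c.noise 0), Matrix.mul_assoc c.C1ᵀ,
      c.C1_mul_noise_eq_zero h1]
    simp
  have e2 : ∀ k ∈ Finset.range N, (c.Cᵀ * c.H h k * c.C * (c.H h (k + 1))⁻¹).trace =
      ∑ j, c.s j ^ 2 := by
    intro k hk
    rw [c.cost_middle (Finset.mem_range.1 hk) (hp _), Matrix.mul_assoc _ _ (c.noise (k + 1)),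
      Matrix.mul_assoc _ c.C, c.C_mul_noise_eq_zero hC hL (Finset.mem_range.1 hk)]
    simp
  have e3 : (c.CLᵀ * c.H h N * c.CL).trace = ∑ j, c.s j ^ 2 := by
    rw [cost_last, c.lastNoise_eq_zero hL]
    simp
  rw [cost, e1, Finset.sum_congr rfl e2, e3, Finset.sum_const, Finset.card_range, nsmul_eq_mul]
  push_cast
  apply le_of_eq
  ring

end SingularChain

/-! ### Realizing inner products by network parameters -/

theorem exists_rank_factorization {p q : ℕ} (M : Matrix (Fin q) (Fin p) ℝ) :
    ∃ (M₂ : Matrix (Fin q) (Fin M.rank) ℝ) (M₁ : Matrix (Fin M.rank) (Fin p) ℝ),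
      M₂ * M₁ = M := by
  let β : Module.Basis (Fin M.rank) ℝ (LinearMap.range M.mulVecLin) := Module.finBasis ℝ _
  let y : Fin p → LinearMap.range M.mulVecLin := fun j => ⟨M *ᵥ Pi.single j 1, Pi.single j 1, rfl⟩
  refine ⟨Matrix.of fun i k => (β k : Fin q → ℝ) i, Matrix.of fun k j => β.repr (y j) k, ?_⟩
  ext i j
  have h := congrArg (fun z : LinearMap.range M.mulVecLin => (z : Fin q → ℝ) i)
    (β.sum_repr (y j))
  simp only [Submodule.coe_sum, Submodule.coe_smul, Finset.sum_apply, Pi.smul_apply,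
    smul_eq_mul, y, mulVec_single_one] at h
  rw [Matrix.mul_apply]
  simp only [of_apply]
  rw [← col_apply M j i, ← h]
  refine Finset.sum_congr rfl fun k _ => ?_
  simp only [y, mulVec_single_one]
  exact mul_comm _ _

/-- A rank factorization, with one-sided inverses of its factors. -/
theorem exists_rank_factorization_inverse {p q : ℕ} (M : Matrix (Fin q) (Fin p) ℝ) :
    ∃ (m : ℕ) (M₂ : Matrix (Fin q) (Fin m) ℝ) (M₁ : Matrix (Fin m) (Fin p) ℝ)
      (U₂ : Matrix (Fin m) (Fin q) ℝ) (U₁ : Matrix (Fin p) (Fin m) ℝ),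
      m = M.rank ∧ M₂ * M₁ = M ∧ U₂ * M₂ = 1 ∧ M₁ * U₁ = 1 := by
  obtain ⟨M₂, M₁, h⟩ := exists_rank_factorization M
  have h1 : (1 : Matrix (Fin M.rank) (Fin M.rank) ℝ).rank ≤
      ((1 : Matrix (Fin M.rank) (Fin M.rank) ℝ) * M₁).rank := by
    rw [rank_one, Matrix.one_mul, Fintype.card_fin]
    have := rank_mul_le_right M₂ M₁
    rwa [h] at this
  have h2 : (1 : Matrix (Fin M.rank) (Fin M.rank) ℝ).rank ≤
      (M₂ * (1 : Matrix (Fin M.rank) (Fin M.rank) ℝ)).rank := by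
    rw [rank_one, Matrix.mul_one, Fintype.card_fin]
    have := rank_mul_le_left M₂ M₁
    rwa [h] at this
  obtain ⟨U₁, hU₁⟩ := exists_eq_mul_mul_of_rank_le h1
  obtain ⟨U₂, hU₂⟩ := exists_eq_mul_mul_of_rank_le' h2
  exact ⟨M.rank, M₂, M₁, U₂, U₁, rfl, h, by simpa using hU₂.symm, by simpa using hU₁.symm⟩

/-- Write `H = Qᵀ Q` and follow `Q` by a coordinate isometry `J` into the wider space; `R` is `Q⁻¹
Jᵀ`. -/
theorem exists_gram_factor {m e : ℕ} (hme : m ≤ e) {H : Matrix (Fin m) (Fin m) ℝ}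
    (hH : H.PosDef) : ∃ (T : Matrix (Fin e) (Fin m) ℝ) (R : Matrix (Fin m) (Fin e) ℝ),
      R * T = 1 ∧ Tᵀ * T = H ∧ R * Rᵀ = H⁻¹ := by
  obtain ⟨Q, rfl⟩ := PosSemidef.exists_eq_transpose_mul_self hH.posSemidef
  have hQ : IsUnit Q.det := by
    have := (isUnit_iff_isUnit_det _).1 hH.isUnit
    rw [det_mul] at this
    exact isUnit_of_mul_isUnit_right this
  set J : Matrix (Fin e) (Fin m) ℝ := (1 : Matrix (Fin e) (Fin e) ℝ).submatrix id (Fin.castLE hme)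
  have hJ : Jᵀ * J = 1 := by
    have : Jᵀ * J = ((1 : Matrix (Fin e) (Fin e) ℝ)ᵀ * 1).submatrix
        (Fin.castLE hme) (Fin.castLE hme) := by
      rw [submatrix_mul _ _ _ id _ Function.bijective_id, transpose_submatrix]
    rw [this, transpose_one, Matrix.mul_one,
      submatrix_one _ (Fin.castLE_injective hme)]
  refine ⟨J * Q, Q⁻¹ * Jᵀ, ?_, ?_, ?_⟩
  · rw [Matrix.mul_assoc, ← Matrix.mul_assoc Jᵀ, hJ, Matrix.one_mul, nonsing_inv_mul _ hQ]
  · rw [transpose_mul, Matrix.mul_assoc, ← Matrix.mul_assoc Jᵀ, hJ, Matrix.one_mul]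
  · rw [transpose_mul, transpose_transpose, Matrix.mul_assoc, ← Matrix.mul_assoc Jᵀ, hJ,
      Matrix.one_mul, Matrix.mul_inv_rev, transpose_nonsing_inv]

section Network

variable {L : ℕ} {d : ℕ → ℕ} {m : ℕ}

/-- The parameters whose `i`-th layer is `l (i + 1) * r i`. -/
def factoredParams (L : ℕ) (l : ∀ i, Matrix (Fin (d i)) (Fin m) ℝ)
    (r : ∀ i, Matrix (Fin m) (Fin (d i)) ℝ) : Params L d :=
  WithLp.toLp 2 fun x => (l (x.1 + 1) * r x.1) x.2.1 x.2.2

variable {l : ∀ i, Matrix (Fin (d i)) (Fin m) ℝ} {r : ∀ i, Matrix (Fin m) (Fin (d i)) ℝ}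

theorem layer_factoredParams (i : Fin L) :
    layer (factoredParams L l r) i = l (i + 1) * r i := rfl

theorem partialProd_factoredParams (hrl : ∀ i, 0 < i → i < L → r i * l i = 1) (k : ℕ)
    (hk : k + 1 ≤ L) : partialProd (factoredParams L l r) (k + 1) hk = l (k + 1) * r 0 := by
  induction k with
  | zero => exact Matrix.mul_one _
  | succ k ih =>
    rw [partialProd, ih, layer_factoredParams, Matrix.mul_assoc, ← Matrix.mul_assoc (r _),
      hrl _ (Nat.succ_pos k) hk, Matrix.one_mul]

theorem suffixProd_factoredParams (hrl : ∀ i, 0 < i → i < L → r i * l i = 1) (k : ℕ)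
    (hk : k < L) : suffixProd (factoredParams L l r) k hk.le = l L * r k := by
  obtain ⟨n, hn⟩ := Nat.exists_eq_add_of_lt hk
  induction n generalizing k with
  | zero =>
    rw [add_zero] at hn
    subst hn
    rw [suffixProd_eq_mul _ k hk, suffixProd_self, layer_factoredParams, Matrix.one_mul]
  | succ n ih =>
    rw [suffixProd_eq_mul _ k hk, ih (k + 1) (by omega) (by omega), layer_factoredParams,
      Matrix.mul_assoc, ← Matrix.mul_assoc (r _), hrl _ (Nat.succ_pos k) (by omega),
      Matrix.one_mul]

end Network

theorem frobSq_mul_eq_trace {e e' m : Type*} [Fintype e] [Fintype e'] [Fintype m]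
    (Y : Matrix e m ℝ) (R : Matrix m e' ℝ) :
    frobSq (Y * R) = (Yᵀ * Y * (R * Rᵀ)).trace := by
  rw [frobSq_eq_trace, transpose_mul, Matrix.mul_assoc, trace_mul_comm]
  simp only [Matrix.mul_assoc]

theorem frobSq_mul_eq_trace' {e e' m : Type*} [Fintype e] [Fintype e'] [Fintype m]
    (T : Matrix e m ℝ) (Y : Matrix m e' ℝ) :
    frobSq (T * Y) = (Yᵀ * (Tᵀ * T) * Y).trace := by
  rw [frobSq_eq_trace, transpose_mul]
  simp only [Matrix.mul_assoc]

/-- Every family of intermediate inner products is realized by network parameters. -/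
theorem exists_params_of_cost {N m : ℕ} {d : ℕ → ℕ} (hm : ∀ i, i ≤ N + 2 → m ≤ d i)
    (B : Matrix (Fin (d 0)) (Fin (d (N + 2))) ℝ) (M₂ : Matrix (Fin (d (N + 2))) (Fin m) ℝ)
    (M₁ : Matrix (Fin m) (Fin (d 0)) ℝ)
    (c : SingularChain N (d 0) (d (N + 2)) m) (h1 : c.C1 = B * M₂) (hC : c.C = M₁ * B * M₂)
    (hL : c.CL = M₁ * B) (H : ℕ → Matrix (Fin m) (Fin m) ℝ) (hH : ∀ k, (H k).PosDef) :
    ∃ W : Params (N + 2) d, endToEnd W = M₂ * M₁ ∧ ∑ i, frobSq (layerGrad B W i) = c.cost H := by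
  -- The hidden space `i`, for `1 ≤ i ≤ N + 1`, carries `H (i - 1)`. The relevant end factors are
  -- replaced below by `M₁` and `M₂`.
  have hTR : ∀ i, ∃ (T : Matrix (Fin (d i)) (Fin m) ℝ) (R : Matrix (Fin m) (Fin (d i)) ℝ),
      i ≤ N + 2 → R * T = 1 ∧ Tᵀ * T = H (i - 1) ∧ R * Rᵀ = (H (i - 1))⁻¹ := by
    intro i
    by_cases hi : i ≤ N + 2
    · obtain ⟨T, R, h⟩ := exists_gram_factor (hm i hi) (hH (i - 1))
      exact ⟨T, R, fun _ => h⟩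
    · exact ⟨0, 0, fun h => absurd h hi⟩
  choose T R hTR using hTR
  set l := Function.update T (N + 2) M₂ with hl
  set r := Function.update R 0 M₁ with hr
  have hlT : ∀ i, i < N + 2 → l i = T i := fun i hi => Function.update_of_ne hi.ne _ _
  have hrR : ∀ i, 0 < i → r i = R i := fun i hi => Function.update_of_ne hi.ne' _ _
  have hlL : l (N + 2) = M₂ := Function.update_self _ _ _
  have hr0 : r 0 = M₁ := Function.update_self _ _ _
  have hrl : ∀ i, 0 < i → i < N + 2 → r i * l i = 1 := fun i h0 hi => by
    rw [hlT i hi, hrR i h0]; exact (hTR i hi.le).1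
  refine ⟨factoredParams (N + 2) l r, ?_, ?_⟩
  · rw [endToEnd, partialProd_factoredParams hrl, hr0, hlL]
  · rw [Fin.sum_univ_succ, Fin.sum_univ_castSucc, SingularChain.cost, ← add_assoc]
    congr 2
    · change frobSq ((1 : Matrix (Fin (d 0)) (Fin (d 0)) ℝ) * B *
        suffixProd (factoredParams (N + 2) l r) 1 (by omega)) = _
      rw [suffixProd_factoredParams hrl _ (by omega), hlL, hrR _ (by omega), Matrix.one_mul,
        ← Matrix.mul_assoc, ← h1, frobSq_mul_eq_trace, (hTR 1 (by omega)).2.2]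
    · rw [← Fin.sum_univ_eq_sum_range (fun k => (c.Cᵀ * H k * c.C * (H (k + 1))⁻¹).trace)]
      refine Finset.sum_congr rfl fun k _ => ?_
      change frobSq (partialProd (factoredParams (N + 2) l r) (k + 1) (by omega) * B *
        suffixProd (factoredParams (N + 2) l r) (k + 2) (by omega)) = _
      have e : T (k + 1) * M₁ * B * (M₂ * R (k + 2)) = T (k + 1) * c.C * R (k + 2) := by
        rw [hC]; simp only [Matrix.mul_assoc]
      rw [suffixProd_factoredParams hrl _ (by omega), partialProd_factoredParams hrl, hlL, hr0,
        hrR _ (by omega), hlT _ (by omega), e, frobSq_mul_eq_trace, (hTR (k + 2) (by omega)).2.2,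
        transpose_mul, Matrix.mul_assoc c.Cᵀ, ← Matrix.mul_assoc (T (k + 1))ᵀ,
        (hTR (k + 1) (by omega)).2.1, ← Matrix.mul_assoc c.Cᵀ]
      rfl
    · change frobSq (partialProd (factoredParams (N + 2) l r) (N + 1) (by omega) * B *
        suffixProd (factoredParams (N + 2) l r) (N + 2) le_rfl) = _
      rw [suffixProd_self, partialProd_factoredParams hrl, hr0, hlT _ (by omega), Matrix.mul_one,
        Matrix.mul_assoc, ← hL, frobSq_mul_eq_trace', (hTR (N + 1) (by omega)).2.1]
      rfl

end DeepLinear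

end

/-! ### The induced regularizer -/

theorem theorem6 (L : ℕ) (hL : 2 ≤ L) (d : ℕ → ℕ)
    (hd : ∀ i, i ≤ L → min (d 0) (d L) ≤ d i)
    (A : Matrix (Fin (d L)) (Fin (d 0)) ℝ) (b : ℝ)
    (M : Matrix (Fin (d L)) (Fin (d 0)) ℝ) :
    DeepLinear.inducedRegularizer (fun _ : Fin 1 => A) (fun _ => b) M =
        2 * (L : ℝ) *
          DeepLinear.schattenNorm (2 / (L : ℝ))
            ((A.transpose * M) ^ (L - 1) * A.transpose) ^ (2 / (L : ℝ)) ∧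
      IsGLB (DeepLinear.hessianTraces (fun _ : Fin 1 => A) (fun _ => b) M)
        (DeepLinear.inducedRegularizer (fun _ : Fin 1 => A) (fun _ => b) M) ∧
      ((A.transpose * M).rank = ((A.transpose * M) ^ (L - 1) * A.transpose).rank →
        (M * A.transpose).rank = ((A.transpose * M) ^ (L - 1) * A.transpose).rank →
        IsLeast (DeepLinear.hessianTraces (fun _ : Fin 1 => A) (fun _ => b) M)
          (DeepLinear.inducedRegularizer (fun _ : Fin 1 => A) (fun _ => b) M)) := by
  open DeepLinear Matrix in
  obtain ⟨N, rfl⟩ := Nat.exists_eq_add_of_le' hL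
  set B := A.transpose
  set X := (B * M) ^ (N + 2 - 1) * B with hX
  rw [schattenNorm_rpow (by positivity)]
  set t₀ := ∑ j, singVal X j ^ (2 / ((N + 2 : ℕ) : ℝ)) with ht₀
  have hlow : ∀ t ∈ hessianTraces (fun _ : Fin 1 => A) (fun _ => b) M,
      2 * ((N + 2 : ℕ) : ℝ) * t₀ ≤ t := by
    rintro t ⟨W, hW, rfl⟩
    rw [trace_hessian_loss_one]
    have := mul_sum_singVal_rpow_le (Nat.succ_pos _) B W
    rw [hW] at this
    linarith
  obtain ⟨m, M₂, M₁, U₂, U₁, hmr, hM, hU₂, hU₁⟩ := exists_rank_factorization_inverse M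
  -- The width hypothesis lets `ℝ^m` fit into every hidden space.
  have hm : ∀ i, i ≤ N + 2 → m ≤ d i := fun i hi => hmr.le.trans <|
    (le_min (by simpa using M.rank_le_width) (by simpa using M.rank_le_height)).trans (hd i hi)
  obtain ⟨V, -, hV, hgram⟩ := exists_singular_matrix X
  have hXc : B * M₂ * (M₁ * B * M₂) ^ N * (M₁ * B) = X := by
    have e := mul_pow_mul_eq_pow_mul_mul M₁ (B * M₂) N
    rw [hX, ← hM, Nat.add_sub_assoc (by norm_num) N, pow_succ', Matrix.mul_assoc M₁ B M₂,
      Matrix.mul_assoc (B * M₂), ← Matrix.mul_assoc (_ ^ N) M₁, ← e]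
    simp only [Matrix.mul_assoc]
  have hpow : ∀ j, (singVal X j ^ (1 / ((N + 2 : ℕ) : ℝ))) ^ (2 * N + 4) = singVal X j ^ 2 := by
    intro j
    have e : 2 * N + 4 = (N + 2) * 2 := by ring
    rw [e, pow_mul, one_div, Real.rpow_inv_natCast_pow (singVal_nonneg _ _) (by omega)]
  have hsq : ∀ j, (singVal X j ^ (1 / ((N + 2 : ℕ) : ℝ))) ^ 2 =
      singVal X j ^ (2 / ((N + 2 : ℕ) : ℝ)) := by
    intro j
    rw [← Real.rpow_natCast, ← Real.rpow_mul (singVal_nonneg _ _)]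
    congr 1; push_cast; ring
  let c : SingularChain N (d 0) (d (N + 2)) m :=
    { C1 := B * M₂
      C := M₁ * B * M₂
      CL := M₁ * B
      V := V
      s := fun j => singVal X j ^ (1 / ((N + 2 : ℕ) : ℝ))
      V_mul_transpose := hV
      gram := by simp only [hXc, hgram, hpow] }
  have hcs : ∑ j, c.s j ^ 2 = t₀ := Finset.sum_congr rfl fun j _ => hsq j
  have hreal : ∀ H, (∀ k, (H k).PosDef) →
      2 * c.cost H ∈ hessianTraces (fun _ : Fin 1 => A) (fun _ => b) M := by
    intro H hH
    obtain ⟨W, hW, hc⟩ := exists_params_of_cost hm B M₂ M₁ c rfl rfl rfl H hH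
    exact ⟨W, hW.trans hM, by rw [trace_hessian_loss_one, hc]⟩
  have hglb : IsGLB (hessianTraces (fun _ : Fin 1 => A) (fun _ => b) M)
      (2 * ((N + 2 : ℕ) : ℝ) * t₀) := by
    refine ⟨fun t ht => hlow t ht, fun u hu => ?_⟩
    refine le_of_forall_pos_le_add fun ε hε => ?_
    obtain ⟨H, hH, hcost⟩ := c.exists_cost_le (half_pos hε)
    have := hu (hreal H hH)
    rw [hcs] at hcost
    linarith
  have hne : (hessianTraces (fun _ : Fin 1 => A) (fun _ => b) M).Nonempty :=
    ⟨_, hreal (fun _ => 1) fun _ => PosDef.one⟩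
  have heq : inducedRegularizer (fun _ : Fin 1 => A) (fun _ => b) M =
      2 * ((N + 2 : ℕ) : ℝ) * t₀ := hglb.csInf_eq hne
  refine ⟨heq, heq ▸ hglb, fun h1 h2 => ?_⟩
  rw [heq]
  have hcX : c.X = X := hXc
  have hr1 : c.C1.rank ≤ c.X.rank := by
    rw [hcX, ← h1]
    -- The one-sided inverses transfer the rank hypotheses on `B * M` and `M * B` to the chain
    -- factors.
    have e : B * M₂ = B * M * U₁ := by
      rw [← hM, Matrix.mul_assoc, Matrix.mul_assoc, hU₁, Matrix.mul_one]
    change (B * M₂).rank ≤ _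
    rw [e]
    exact rank_mul_le_left _ _
  have hrC : c.C.rank ≤ c.X.rank := by
    refine le_trans ?_ hr1
    change (M₁ * B * M₂).rank ≤ (B * M₂).rank
    rw [Matrix.mul_assoc]
    exact rank_mul_le_right _ _
  have hrL : c.CL.rank ≤ c.X.rank := by
    rw [hcX, ← h2]
    have e : M₁ * B = U₂ * (M * B) := by
      rw [← hM, ← Matrix.mul_assoc, ← Matrix.mul_assoc, hU₂, Matrix.one_mul]
    change (M₁ * B).rank ≤ _
    rw [e]
    exact rank_mul_le_right _ _
  obtain ⟨H, hH, hcost⟩ := c.exists_cost_le_of_rank_le hr1 hrC hrL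
  rw [hcs] at hcost
  have hmem := hreal H hH
  have : 2 * c.cost H = 2 * ((N + 2 : ℕ) : ℝ) * t₀ :=
    le_antisymm (by linarith) (hlow _ hmem)
  exact ⟨this ▸ hmem, hglb.1⟩
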